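/- Let $G=(V,E)$ be a finite simple graph with maximum degree $\Delta\ge 1$ and girth $g\in\{3,4,5,\dots\}\cup\{+\infty\}$ (with $g=+\infty$ when $G$ has no cycle), and fix a total order on $E$. A broken circuit of a subgraph of $G$ is the edge set of a cycle of that subgraph with its largest edge removed. For $U\subseteq V$ let $\mathcal F_U$ be the set of all broken-circuit-free (BCF) forests of the induced subgraph $G|_U$, that is, of all sets $F$ of edges of $G|_U$ (the empty set included) which contain no cycle and no broken circuit of $G|_U$. Put $$F_U(z)=\sum_{F\in\mathcal F_U}z^{|F|},\qquad F_G(z)=F_V(z),\qquad R^u_G(z)=\frac{F_V(z)}{F_{V\setminus\{u\}}(z)}-1\quad(u\in V,\ F_{V\setminus\{u\}}(z)\ne 0).$$ Define $\rho_\Delta=\left(\frac{\Delta-1}{\Delta-2}\right)^{\Delta}$ and $R_\Delta=\frac{(\Delta-2)^{\Delta-2}}{(\Delta-1)^{\Delta-1}}$ for $\Delta\ge3$, $\rho_2=\rho_1=+\infty$, $R_2=1$, $R_1=+\infty$. For $b\in[1,\rho_\Delta)$, $d\in\mathbb N$ and $a\in[0,1]$ let $$x_\Delta(b)=\frac{b^{2/\Delta}-b^{1/\Delta}}{b},\qquad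 f_\Delta^d(b)=\frac{1}{\Delta-1}\cdot\frac{[(\Delta-1)(1-b^{-1/\Delta})]^d}{1-(\Delta-1)(1-b^{-1/\Delta})}\ (\Delta\ge 2),\qquad f_\Delta^{\infty}(b)=0,$$ $$K_\Delta^g(a,b)=\bigl[1+(1-a)x_\Delta(b)\bigr]^{\Delta}-1+f_\Delta^{g-2}(b)\binom{\Delta}{2}\,b\,x_\Delta(b)\,\bigl(1+b\,x_\Delta(b)\bigr)^{\Delta-1},$$ $$b_\Delta^g(a)=\sup\{b\in[1,\rho_\Delta):K_\Delta^g(a,b)\le a\},\qquad z_\Delta^g(a)=(1-a)\,x_\Delta\bigl(b_\Delta^g(a)\bigr),$$ where $x_\Delta(\rho_\Delta):=\lim_{b\to\rho_\Delta}x_\Delta(b)=R_\Delta$, and $z_1^\infty(1):=0$ by convention. Then for every $a\in[0,1]$ and every $z\in\mathbb C$ with $|z|\le z_\Delta^g(a)$ we have $F_G(z)\neq0$, and for every vertex $u\in V$ we have $F_{V\setminus\{u\}}(z)\ne0$ (so that $R^u_G(z)$ is defined) and $|R^u_G(z)|\le a$. -/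

import Mathlib

namespace BCF

/-! Broken-circuit-free forests. A forest is regarded as its set of edges. The edge order is a
strict relation `r` (read `r f e` as `f ≺ e`) which is a total order on the edges of the graph. -/

/-- `B` is a broken circuit of `G`: the edge set of a cycle of `G` with its largest edge removed. -/
def IsBrokenCircuit {V : Type*} (G : SimpleGraph V) (r : Sym2 V → Sym2 V → Prop)
    (B : Set (Sym2 V)) : Prop :=
  ∃ (v : V) (c : G.Walk v v), c.IsCycle ∧
    ∃ e ∈ c.edges, (∀ f ∈ c.edges, f ≠ e → r f e) ∧ B = {f | f ∈ c.edges ∧ f ≠ e}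

/-- `A` is a broken-circuit-free forest of `G`. (A broken circuit is the edge set of a path, so
it lies in `A` if and only if it lies in one of the trees of `A`.) -/
def IsBCFForest {V : Type*} (G : SimpleGraph V) (r : Sym2 V → Sym2 V → Prop)
    (A : Set (Sym2 V)) : Prop :=
  A ⊆ G.edgeSet ∧ (SimpleGraph.fromEdgeSet A).IsAcyclic ∧
    ∀ B : Set (Sym2 V), IsBrokenCircuit G r B → ¬ B ⊆ A

open Classical in
/-- `F_G(z)`, the sum of `z ^ |F|` over all BCF forests `F` of `G`, the empty one included. -/
noncomputable def genFun {V : Type*} [Fintype V] (G : SimpleGraph V)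
    (r : Sym2 V → Sym2 V → Prop) (z : ℂ) : ℂ :=
  ∑ A ∈ (Finset.univ : Finset (Finset (Sym2 V))).filter
    (fun A : Finset (Sym2 V) => IsBCFForest G r (A : Set (Sym2 V))), z ^ A.card

/-- The restriction of `G` to the vertex set `U`: its edges are those of `G` with both ends
in `U`. (The type of vertices is kept; the vertices outside `U` lie in no edge, so they play no
role in sets of edges.) -/
def restrict {V : Type*} (G : SimpleGraph V) (U : Set V) : SimpleGraph V where
  Adj v w := v ∈ U ∧ w ∈ U ∧ G.Adj v w
  symm := ⟨fun _ _ h => ⟨h.2.1, h.1, h.2.2.symm⟩⟩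
  loopless := ⟨fun _ h => G.irrefl h.2.2⟩

/-- `F_{V - u}(z)`. -/
noncomputable def genFunDelete {V : Type*} [Fintype V] (G : SimpleGraph V)
    (r : Sym2 V → Sym2 V → Prop) (u : V) (z : ℂ) : ℂ :=
  genFun (restrict G {u}ᶜ) r z

/-- `R^u_G(z) = F_G(z) / F_{V - u}(z) - 1`, meaningful where `F_{V - u}(z) ≠ 0`. (If `u` is the
only vertex, both functions are `1` and the value is `0`.) -/
noncomputable def ratio {V : Type*} [Fintype V] (G : SimpleGraph V)
    (r : Sym2 V → Sym2 V → Prop) (u : V) (z : ℂ) : ℂ :=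
  genFun G r z / genFunDelete G r u z - 1

/-! The radius, for `Δ ≥ 1` and `3 ≤ g ≤ ∞`. -/

/-- `ρ_Δ`, equal to `((Δ - 1) / (Δ - 2)) ^ Δ` for `Δ ≥ 3` and to `+∞` for `Δ = 1, 2`. -/
noncomputable def rho (Δ : ℕ) : EReal :=
  if Δ ≤ 2 then ⊤ else (((((Δ : ℝ) - 1) / ((Δ : ℝ) - 2)) ^ Δ : ℝ) : EReal)

/-- `R_Δ`, equal to `(Δ - 2) ^ (Δ - 2) / (Δ - 1) ^ (Δ - 1)` for `Δ ≥ 3`, to `1` for `Δ = 2` and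
to `+∞` for `Δ = 1`. -/
noncomputable def bigR (Δ : ℕ) : EReal :=
  if Δ ≤ 1 then ⊤ else if Δ = 2 then 1
  else ((((Δ : ℝ) - 2) ^ (Δ - 2) / ((Δ : ℝ) - 1) ^ (Δ - 1) : ℝ) : EReal)

/-- `x_Δ(b) = (b ^ (2 / Δ) - b ^ (1 / Δ)) / b` for real `b ∈ [1, ρ_Δ)`. -/
noncomputable def xFun (Δ : ℕ) (b : ℝ) : ℝ :=
  (b ^ ((2 : ℝ) / Δ) - b ^ ((1 : ℝ) / Δ)) / b

/-- `x_Δ` on `[1, ρ_Δ]`, with its limit `R_Δ` as the value at the right end `ρ_Δ`. -/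
noncomputable def xExt (Δ : ℕ) (b : EReal) : EReal :=
  if b < rho Δ then (xFun Δ b.toReal : EReal) else bigR Δ

/-- `f^d_Δ(b)`, equal to `0` for `d = ∞`. -/
noncomputable def fFun (Δ : ℕ) (d : ℕ∞) (b : ℝ) : ℝ :=
  if d = ⊤ then 0
  else 1 / ((Δ : ℝ) - 1) *
    ((((Δ : ℝ) - 1) * (1 - b ^ (-(1 : ℝ) / Δ))) ^ d.toNat /
      (1 - ((Δ : ℝ) - 1) * (1 - b ^ (-(1 : ℝ) / Δ))))

/-- `K^g_Δ(a, b)`. -/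
noncomputable def kFun (Δ : ℕ) (g : ℕ∞) (a b : ℝ) : ℝ :=
  (1 + (1 - a) * xFun Δ b) ^ Δ - 1 +
    fFun Δ (g - 2) b * (Δ.choose 2 : ℝ) * (b * xFun Δ b) * (1 + b * xFun Δ b) ^ (Δ - 1)

/-- `b^g_Δ(a)`, the supremum of all `b ∈ [1, ρ_Δ)` with `K^g_Δ(a, b) ≤ a`; it may be `+∞`. -/
noncomputable def bSup (Δ : ℕ) (g : ℕ∞) (a : ℝ) : EReal :=
  sSup {b : EReal | ∃ t : ℝ, b = (t : EReal) ∧ 1 ≤ t ∧ (t : EReal) < rho Δ ∧ kFun Δ g a t ≤ a}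

/-- `z^g_Δ(a) = (1 - a) x_Δ(b^g_Δ(a))`, with the convention `z_1(1) = 0`, where the product would
be `0 · ∞`. In all other cases it is a finite number. -/
noncomputable def zRadius (Δ : ℕ) (g : ℕ∞) (a : ℝ) : EReal :=
  if Δ = 1 ∧ a = 1 then 0 else ((1 - a : ℝ) : EReal) * xExt Δ (bSup Δ g a)

end BCF

namespace BCF

/-! The estimate |F_U − F_{U∖u}| ≤ a |F_{U∖u}| holds for every vertex set U and every u, by
induction on |U|. For a < 1 it yields both the nonvanishing of all F_U and the bound on the ratio;
for a = 1 the radius is 0.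

Expansion at u. Whitney's cancellation turns F_G into a signed sum over all edge sets in which only
the partition into components matters, so F_G does not depend on the edge order
(`genFun_order_independent`). With the edges at u placed last, a BCF forest is a BCF forest A of G −
u together with, for each component of A meeting N(u), at most one prescribed edge to u. Hence F_U
is the sum of z^|A| (1+z)^c(A), where c(A) counts these components (`genFun_eq_sum_restrict`). If
the neighbours of u always lay in distinct components, this would be (1+z)^|N(u)| F_{U∖u}, which
accounts for the first part of K.

Correction. The neighbours are marked one at a time, and every error term is a tree T joining two of
them, times a sum over forests off T. By induction each deleted vertex costs a factor 1/(1−a), so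
|z| ≤ (1−a)x turns z^|T| into x^|T|, up to one factor 1/(1−a) (`Stable.tree_term_le`). Only sums of
x^|T| over trees remain. They are compared with the Δ-regular tree: for x = x_Δ(b), the trees
through a vertex weigh at most b (`treeSum_edgesIn_le`). Two neighbours of u are at distance at
least g − 2 in G − u, and a geometric series along the path bounds the trees through both by b
f^{g−2}(b) (`pairSum_le`). The total is K(a,b) ≤ a.

Continuity of x_Δ supplies a suitable b below the radius, and continuity of F in z gives the closed
disc. -/

section Development

open scoped Classical

/-! ### Connectivity by a set of edges, and acyclic edge sets -/

section Connectivity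

variable {V : Type*}

/-- `Conn A v w`: the vertices `v` and `w` are joined by edges of `A`. -/
def Conn (A : Set (Sym2 V)) (v w : V) : Prop :=
  Relation.ReflTransGen (fun x y => s(x, y) ∈ A) v w

theorem Conn.refl (A : Set (Sym2 V)) (v : V) : Conn A v v := Relation.ReflTransGen.refl

theorem Conn.trans {A : Set (Sym2 V)} {u v w : V} (h : Conn A u v) (h' : Conn A v w) :
    Conn A u w := Relation.ReflTransGen.trans h h'

theorem Conn.symm {A : Set (Sym2 V)} {v w : V} (h : Conn A v w) : Conn A w v := by
  induction h with
  | refl => exact Conn.refl _ _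
  | tail _ hbc ih =>
    refine Conn.trans (Relation.ReflTransGen.single ?_) ih
    rwa [Sym2.eq_swap]

theorem conn_comm {A : Set (Sym2 V)} {v w : V} : Conn A v w ↔ Conn A w v :=
  ⟨Conn.symm, Conn.symm⟩

theorem Conn.of_mem {A : Set (Sym2 V)} {v w : V} (h : s(v, w) ∈ A) : Conn A v w :=
  Relation.ReflTransGen.single h

/-- A walk that starts in a set `P` closed under the edges of `A`, on which these are edges
of `B`, is a walk along edges of `B` that stays in `P`. -/
theorem Conn.of_closed {A B : Set (Sym2 V)} {P : V → Prop} {v w : V} (h : Conn A v w) (hv : P v)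
    (hP : ∀ x y, P x → s(x, y) ∈ A → s(x, y) ∈ B ∧ P y) : Conn B v w ∧ P w := by
  induction h with
  | refl => exact ⟨Conn.refl _ _, hv⟩
  | tail _ hbc ih =>
    obtain ⟨h1, h2⟩ := hP _ _ ih.2 hbc
    exact ⟨ih.1.trans (Conn.of_mem h1), h2⟩

theorem Conn.mono {A B : Set (Sym2 V)} (hAB : A ⊆ B) {v w : V} (h : Conn A v w) : Conn B v w :=
  (h.of_closed (P := fun _ => True) trivial fun _ _ _ hxy => ⟨hAB hxy, trivial⟩).1

/-- Connectivity by `A` implies connectivity by `B` if every edge of `A` has its ends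
connected by `B`. -/
theorem Conn.lift {A B : Set (Sym2 V)} {v w : V} (h : Conn A v w)
    (hAB : ∀ x y, s(x, y) ∈ A → Conn B x y) : Conn B v w := by
  induction h with
  | refl => exact Conn.refl _ _
  | tail _ hbc ih => exact ih.trans (hAB _ _ hbc)

theorem conn_iff_reachable {A : Set (Sym2 V)} {v w : V} :
    Conn A v w ↔ (SimpleGraph.fromEdgeSet A).Reachable v w := by
  rw [SimpleGraph.reachable_fromEdgeSet_eq_reflTransGen_toRel]
  rfl

/-- A second crossing of the new edge makes the first one superfluous, so at most one crossing, in
either direction, is needed. -/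
theorem conn_insert_iff {A : Set (Sym2 V)} {x y v w : V} :
    Conn (insert s(x, y) A) v w ↔
      Conn A v w ∨ (Conn A v x ∧ Conn A y w) ∨ (Conn A v y ∧ Conn A x w) := by
  constructor
  · intro h
    induction h with
    | refl => exact Or.inl (Conn.refl _ _)
    | @tail b c _ hbc ih =>
      rcases hbc with hbc | hbc
      · rcases Sym2.eq_iff.1 hbc with ⟨rfl, rfl⟩ | ⟨rfl, rfl⟩
        · rcases ih with h | ⟨h, h'⟩ | ⟨h, h'⟩
          · exact Or.inr (Or.inl ⟨h, Conn.refl _ _⟩)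
          · exact Or.inr (Or.inl ⟨h, Conn.refl _ _⟩)
          · exact Or.inl h
        · rcases ih with h | ⟨h, h'⟩ | ⟨h, h'⟩
          · exact Or.inr (Or.inr ⟨h, Conn.refl _ _⟩)
          · exact Or.inl h
          · exact Or.inr (Or.inr ⟨h, Conn.refl _ _⟩)
      · rcases ih with h | ⟨h, h'⟩ | ⟨h, h'⟩
        · exact Or.inl (h.trans (Conn.of_mem hbc))
        · exact Or.inr (Or.inl ⟨h, h'.trans (Conn.of_mem hbc)⟩)
        · exact Or.inr (Or.inr ⟨h, h'.trans (Conn.of_mem hbc)⟩)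
  · have hxy : Conn (insert s(x, y) A) x y := Conn.of_mem (Set.mem_insert _ _)
    have hm := Set.subset_insert s(x, y) A
    rintro (h | ⟨h, h'⟩ | ⟨h, h'⟩)
    · exact h.mono hm
    · exact ((h.mono hm).trans hxy).trans (h'.mono hm)
    · exact ((h.mono hm).trans hxy.symm).trans (h'.mono hm)

theorem conn_empty_iff {v w : V} : Conn (∅ : Set (Sym2 V)) v w ↔ v = w := by
  constructor
  · intro h
    induction h with
    | refl => rfl
    | tail _ h _ => exact absurd h (Set.notMem_empty _)
  · rintro rfl
    exact Conn.refl _ _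

/-- A path that ends away from `v` can be shortened so that it leaves `v` only once. -/
theorem Conn.exists_first_step {A : Set (Sym2 V)} {v w : V} (h : Conn A v w) (hvw : v ≠ w) :
    ∃ s, s(v, s) ∈ A ∧ Conn {f ∈ A | v ∉ f} s w := by
  -- The start is generalised so that the induction can run from the head. The second alternative
  -- describes the walk after its last visit to `v`.
  have key : ∀ u, Conn A u w → Conn {f ∈ A | v ∉ f} u w ∨
      ∃ s, s(v, s) ∈ A ∧ Conn {f ∈ A | v ∉ f} s w := by
    intro u hu
    induction hu using Relation.ReflTransGen.head_induction_on with
    | refl => exact Or.inl (Conn.refl _ _)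
    | @head a c hac _ ih =>
      rcases ih with ih | ih
      · by_cases ha : v = a
        · subst ha
          exact Or.inr ⟨c, hac, ih⟩
        by_cases hc : v = c
        · subst hc
          rcases Relation.ReflTransGen.cases_head ih with h | ⟨d, hd, _⟩
          · exact absurd h hvw
          · exact absurd (Sym2.mem_mk_left v d) hd.2
        · exact Or.inl (Conn.trans (Conn.of_mem ⟨hac, by simp [ha, hc]⟩) ih)
      · exact Or.inr ih
  rcases key v h with h | h
  · rcases Relation.ReflTransGen.cases_head h with h | ⟨d, hd, _⟩
    · exact absurd h hvw
    · exact absurd (Sym2.mem_mk_left v d) hd.2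
  · exact h

/-- No edge of `A` has its ends connected by the other edges of `A`. -/
def Acyc (A : Set (Sym2 V)) : Prop :=
  ∀ x y, s(x, y) ∈ A → ¬ Conn (A \ {s(x, y)}) x y

theorem Acyc.mono {A B : Set (Sym2 V)} (hB : Acyc B) (h : A ⊆ B) : Acyc A :=
  fun x y hxy hc => hB x y (h hxy) (hc.mono (Set.sdiff_subset_sdiff_left h))

theorem conn_of_mem_edges_of_isCycle {G : SimpleGraph V} {v x y : V} {c : G.Walk v v}
    (hc : c.IsCycle) (h : s(x, y) ∈ c.edges) :
    Conn {f | f ∈ c.edges ∧ f ≠ s(x, y)} x y := by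
  -- The cycle is moved to the graph formed by its own edges, so that the detour around the deleted
  -- edge uses edges of the cycle only.
  have hE : ∀ f ∈ c.edges, f ∈ (SimpleGraph.fromEdgeSet {f | f ∈ c.edges}).edgeSet := by
    intro f hf
    rw [SimpleGraph.edgeSet_fromEdgeSet]
    exact ⟨hf, G.not_isDiag_of_mem_edgeSet (c.edges_subset_edgeSet hf)⟩
  have := (SimpleGraph.adj_and_reachable_delete_edges_iff_exists_cycle.2
    ⟨v, c.transfer _ hE, hc.transfer hE, by simpa using h⟩).2
  rw [conn_iff_reachable]
  refine this.mono ?_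
  intro a b hab
  simp only [SimpleGraph.deleteEdges_adj, SimpleGraph.fromEdgeSet_adj] at hab ⊢
  exact ⟨⟨hab.1.1, hab.2⟩, hab.1.2⟩

/-- Every edge of an acyclic graph is a bridge. Loops must be excluded because `fromEdgeSet`
discards them, whereas a loop in `A` violates `Acyc`. -/
theorem acyc_of_isAcyclic {A : Set (Sym2 V)} (h : (SimpleGraph.fromEdgeSet A).IsAcyclic)
    (hA : ∀ e ∈ A, ¬ e.IsDiag) : Acyc A := by
  intro x y hxy hc
  have hadj : (SimpleGraph.fromEdgeSet A).Adj x y := ⟨hxy, by simpa using hA _ hxy⟩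
  have hb := SimpleGraph.isAcyclic_iff_forall_adj_isBridge.1 h hadj
  rw [SimpleGraph.isBridge_iff] at hb
  apply hb
  refine (conn_iff_reachable.1 hc).mono ?_
  intro a b hab
  simp only [SimpleGraph.deleteEdges_adj, SimpleGraph.fromEdgeSet_adj] at hab ⊢
  exact ⟨⟨hab.1.1, hab.2⟩, hab.1.2⟩

end Connectivity

/-! ### Strict total orders on a set of edges -/

section Order

/-- `r` is a strict total order on the set `E`. -/
structure StrictTotalOn {α : Type*} (r : α → α → Prop) (E : Set α) : Prop where
  irrefl : ∀ e ∈ E, ¬ r e e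
  trans : ∀ e ∈ E, ∀ f ∈ E, ∀ g ∈ E, r e f → r f g → r e g
  total : ∀ e ∈ E, ∀ f ∈ E, e ≠ f → r e f ∨ r f e

theorem StrictTotalOn.mono {α : Type*} {r : α → α → Prop} {E E' : Set α}
    (h : StrictTotalOn r E) (hE : E' ⊆ E) : StrictTotalOn r E' where
  irrefl e he := h.irrefl e (hE he)
  trans e he f hf g hg := h.trans e (hE he) f (hE hf) g (hE hg)
  total e he f hf := h.total e (hE he) f (hE hf)

theorem StrictTotalOn.asymm {α : Type*} {r : α → α → Prop} {E : Set α} (h : StrictTotalOn r E)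
    {e f : α} (he : e ∈ E) (hf : f ∈ E) (hef : r e f) : ¬ r f e :=
  fun hfe => h.irrefl e he (h.trans e he f hf e he hef hfe)

theorem StrictTotalOn.exists_max {α : Type*} {r : α → α → Prop} {E : Set α}
    (h : StrictTotalOn r E) (s : Finset α) (hs : s.Nonempty) (hsE : ∀ e ∈ s, e ∈ E) :
    ∃ e ∈ s, ∀ f ∈ s, f ≠ e → r f e := by
  induction hs using Finset.Nonempty.cons_induction with
  | singleton a => exact ⟨a, by simp, by simp⟩
  | cons a s ha hs ih =>
    obtain ⟨e, he, hmax⟩ := ih fun e he => hsE e (Finset.mem_cons_of_mem he)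
    have haE := hsE a (Finset.mem_cons_self a s)
    have heE := hsE e (Finset.mem_cons_of_mem he)
    have hne : e ≠ a := by rintro rfl; exact ha he
    rcases h.total e heE a haE hne with hea | hae
    · refine ⟨a, Finset.mem_cons_self a s, fun f hf hfa => ?_⟩
      rcases Finset.mem_cons.1 hf with rfl | hf'
      · exact absurd rfl hfa
      · by_cases hfe : f = e
        · rwa [hfe]
        · exact h.trans f (hsE f hf) e heE a haE (hmax f hf' hfe) hea
    · refine ⟨e, Finset.mem_cons_of_mem he, fun f hf hfe => ?_⟩
      rcases Finset.mem_cons.1 hf with rfl | hf'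
      · exact hae
      · exact hmax f hf' hfe

end Order

/-! ### BCF forests described by connectivity -/

section Characterization

variable {V : Type*} {G : SimpleGraph V} {r : Sym2 V → Sym2 V → Prop}

/-- A broken circuit whose missing edge is `xy` is a path from `x` to `y` of edges preceding `xy`.
Acyclicity needs no separate condition, since a cycle contains a broken circuit. -/
theorem isBCFForest_iff (hr : StrictTotalOn r G.edgeSet) {A : Set (Sym2 V)} :
    IsBCFForest G r A ↔ A ⊆ G.edgeSet ∧
      ∀ x y, G.Adj x y → ¬ Conn {f ∈ A | r f s(x, y)} x y := by
  -- A general subgraph `H` is allowed because cycles of `fromEdgeSet A` are treated too.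
  have hmax : ∀ {H : SimpleGraph V} {v : V} (c : H.Walk v v), H ≤ G → c.IsCycle →
      ∃ e ∈ c.edges, ∀ f ∈ c.edges, f ≠ e → r f e := by
    intro H v c hH hc
    obtain ⟨e, he, h⟩ := hr.exists_max c.edges.toFinset
      (by
        obtain ⟨e, he⟩ := List.exists_mem_of_ne_nil c.edges
          (by
            intro h0
            have h3 := hc.three_le_length
            rw [← c.length_edges, h0] at h3
            simp at h3)
        exact ⟨e, by simpa using he⟩)
      (fun e he => SimpleGraph.edgeSet_mono hH (c.edges_subset_edgeSet (by simpa using he)))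
    exact ⟨e, by simpa using he, fun f hf => h f (by simpa using hf)⟩
  constructor
  · rintro ⟨hA, _, hB⟩
    refine ⟨hA, fun x y hxy hc => ?_⟩
    have hlt : {f ∈ A | r f s(x, y)} ⊆ A := fun f hf => hf.1
    obtain ⟨p0, hp0⟩ := (conn_iff_reachable.1 hc).symm.exists_isPath
    have hpe : ∀ f ∈ p0.edges, f ∈ A ∧ r f s(x, y) := by
      intro f hf
      have := p0.edges_subset_edgeSet hf
      rw [SimpleGraph.edgeSet_fromEdgeSet] at this
      exact this.1
    let p : G.Walk y x := p0.transfer G fun f hf => hA (hpe f hf).1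
    have hpath : p.IsPath := hp0.transfer _
    have hpedges : p.edges = p0.edges := SimpleGraph.Walk.edges_transfer _ _
    have hirr := hr.irrefl s(x, y) hxy
    have hnot : s(x, y) ∉ p.edges := by
      rw [hpedges]
      exact fun h => hirr (hpe _ h).2
    have hcyc : (SimpleGraph.Walk.cons hxy p).IsCycle :=
      (SimpleGraph.Walk.cons_isCycle_iff p hxy).2 ⟨hpath, hnot⟩
    refine hB {f | f ∈ (SimpleGraph.Walk.cons hxy p).edges ∧ f ≠ s(x, y)}
      ⟨x, _, hcyc, s(x, y), by simp, ?_, rfl⟩ ?_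
    · intro f hf hne
      rw [SimpleGraph.Walk.edges_cons, List.mem_cons] at hf
      rcases hf with hf | hf
      · exact absurd hf hne
      · exact (hpe f (hpedges ▸ hf)).2
    · rintro f ⟨hf, hne⟩
      rw [SimpleGraph.Walk.edges_cons, List.mem_cons] at hf
      rcases hf with hf | hf
      · exact absurd hf hne
      · exact (hpe f (hpedges ▸ hf)).1
  · rintro ⟨hA, h⟩
    have hAG : SimpleGraph.fromEdgeSet A ≤ G := by
      intro x y hxy
      exact hA hxy.1
    have key : ∀ {H : SimpleGraph V} {v : V} (c : H.Walk v v) (e : Sym2 V), H ≤ G → c.IsCycle →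
        e ∈ c.edges → (∀ f ∈ c.edges, f ≠ e → r f e) → ¬ {f | f ∈ c.edges ∧ f ≠ e} ⊆ A := by
      intro H v c e hH hc he hm hsub
      induction e with
      | h x y =>
        refine h x y (hH (c.edges_subset_edgeSet he)) ?_
        refine (conn_of_mem_edges_of_isCycle hc he).mono ?_
        intro f hf
        exact ⟨hsub hf, hm f hf.1 hf.2⟩
    refine ⟨hA, ?_, ?_⟩
    · intro v c hc
      obtain ⟨e, he, hm⟩ := hmax c hAG hc
      refine key c e hAG hc he hm ?_
      intro f hf
      have := c.edges_subset_edgeSet hf.1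
      rw [SimpleGraph.edgeSet_fromEdgeSet] at this
      exact this.1
    · rintro B ⟨v, c, hc, e, he, hm, rfl⟩
      exact key c e le_rfl hc he hm

theorem IsBCFForest.acyc {A : Set (Sym2 V)} (h : IsBCFForest G r A) : Acyc A :=
  acyc_of_isAcyclic h.2.1 fun _ he => G.not_isDiag_of_mem_edgeSet (h.1 he)

end Characterization

/-! ### Counting components of forests -/

section Components

variable {V : Type*} [Fintype V]

/-- The set of the vertices connected to `v` by `A`. -/
noncomputable def supp (A : Set (Sym2 V)) (v : V) : Finset V :=
  Finset.univ.filter (Conn A v)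

/-- The number of components of `A` that meet `N`. -/
noncomputable def compCount (A : Set (Sym2 V)) (N : Finset V) : ℕ :=
  (N.image (supp A)).card

theorem mem_supp {A : Set (Sym2 V)} {v w : V} : w ∈ supp A v ↔ Conn A v w := by simp [supp]

theorem self_mem_supp (A : Set (Sym2 V)) (v : V) : v ∈ supp A v := mem_supp.2 (Conn.refl _ _)

theorem supp_eq_supp_iff {A : Set (Sym2 V)} {v w : V} : supp A v = supp A w ↔ Conn A v w := by
  constructor
  · intro h
    rw [← mem_supp, h]
    exact self_mem_supp A w
  · intro h
    ext x
    rw [mem_supp, mem_supp]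
    exact ⟨fun hx => h.symm.trans hx, fun hx => h.trans hx⟩

theorem compCount_insert {A : Set (Sym2 V)} {x y : V} (hxy : ¬ Conn A x y) :
    compCount (insert s(x, y) A) Finset.univ + 1 = compCount A Finset.univ := by
  have hne : supp A x ≠ supp A y := fun h => hxy (supp_eq_supp_iff.1 h)
  have hyx : ¬ Conn A y x := fun h => hxy h.symm
  set S := supp A x ∪ supp A y with hS
  -- The classes of `x` and `y` are replaced by their union `S`; all other classes persist.
  have h1 : Finset.univ.image (supp (insert s(x, y) A)) =
      insert S (((Finset.univ.image (supp A)).erase (supp A x)).erase (supp A y)) := by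
    have hin : ∀ w, Conn A x w ∨ Conn A y w → supp (insert s(x, y) A) w = S := by
      intro w hw
      ext z
      rw [mem_supp, conn_insert_iff, hS, Finset.mem_union, mem_supp, mem_supp]
      rcases hw with hw | hw
      · constructor
        · rintro (h | ⟨h, h'⟩ | ⟨h, h'⟩)
          exacts [Or.inl (hw.trans h), Or.inr h', Or.inl h']
        · rintro (h | h)
          exacts [Or.inl (hw.symm.trans h), Or.inr (Or.inl ⟨hw.symm, h⟩)]
      · constructor
        · rintro (h | ⟨h, h'⟩ | ⟨h, h'⟩)
          exacts [Or.inr (hw.trans h), Or.inr h', Or.inl h']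
        · rintro (h | h)
          exacts [Or.inr (Or.inr ⟨hw.symm, h⟩), Or.inl (hw.symm.trans h)]
    have hout : ∀ w, ¬ Conn A x w → ¬ Conn A y w → supp (insert s(x, y) A) w = supp A w := by
      intro w hx hy
      ext z
      rw [mem_supp, conn_insert_iff, mem_supp]
      constructor
      · rintro (h | ⟨h, h'⟩ | ⟨h, h'⟩)
        exacts [h, absurd h.symm hx, absurd h.symm hy]
      · exact Or.inl
    ext T
    simp only [Finset.mem_image, Finset.mem_univ, true_and, Finset.mem_insert, Finset.mem_erase]
    constructor
    · rintro ⟨w, rfl⟩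
      by_cases hw : Conn A x w ∨ Conn A y w
      · exact Or.inl (hin w hw)
      · push Not at hw
        right
        rw [hout w hw.1 hw.2]
        exact ⟨fun h => hw.2 (supp_eq_supp_iff.1 h).symm,
          fun h => hw.1 (supp_eq_supp_iff.1 h).symm, w, rfl⟩
    · rintro (rfl | ⟨hy, hx, w, rfl⟩)
      · exact ⟨x, hin x (Or.inl (Conn.refl _ _))⟩
      · exact ⟨w, hout w (fun h => hx (supp_eq_supp_iff.2 h.symm))
          (fun h => hy (supp_eq_supp_iff.2 h.symm))⟩
  have hSnot : S ∉ ((Finset.univ.image (supp A)).erase (supp A x)).erase (supp A y) := by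
    simp only [Finset.mem_erase, Finset.mem_image, Finset.mem_univ, true_and, not_and, not_exists]
    intro _ _ w hw
    have hx : Conn A w x := by
      rw [← mem_supp, hw]; exact Finset.mem_union_left _ (self_mem_supp A x)
    have hy : Conn A w y := by
      rw [← mem_supp, hw]; exact Finset.mem_union_right _ (self_mem_supp A y)
    exact hxy (hx.symm.trans hy)
  rw [compCount, compCount, h1, Finset.card_insert_of_notMem hSnot, Finset.card_erase_of_mem,
    Finset.card_erase_of_mem]
  · have : 2 ≤ (Finset.univ.image (supp A)).card := by
      have : ({supp A x, supp A y} : Finset (Finset V)).card = 2 := Finset.card_pair hne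
      rw [← this]
      apply Finset.card_le_card
      intro T hT
      rcases Finset.mem_insert.1 hT with rfl | hT
      · simp
      · rw [Finset.mem_singleton.1 hT]; simp
    omega
  · simp
  · simp [Finset.mem_erase, hne.symm]

theorem supp_insert_of_conn {A : Set (Sym2 V)} {x y : V} (hxy : Conn A x y) :
    supp (insert s(x, y) A) = supp A := by
  funext w
  ext z
  rw [mem_supp, mem_supp]
  refine ⟨fun h => h.lift ?_, fun h => h.mono (Set.subset_insert _ _)⟩
  intro a b hab
  rcases hab with hab | hab
  · rcases Sym2.eq_iff.1 hab with ⟨rfl, rfl⟩ | ⟨rfl, rfl⟩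
    exacts [hxy, hxy.symm]
  · exact Conn.of_mem hab

theorem compCount_empty : compCount (∅ : Set (Sym2 V)) Finset.univ = Fintype.card V := by
  rw [compCount, Finset.card_image_of_injective, Finset.card_univ]
  intro v w h
  exact conn_empty_iff.1 (supp_eq_supp_iff.1 h)

/-- Starting from singletons, each edge added to a forest merges two components. -/
theorem compCount_add_card {A : Finset (Sym2 V)} (hA : Acyc (A : Set (Sym2 V))) :
    compCount (A : Set (Sym2 V)) Finset.univ + A.card = Fintype.card V := by
  induction A using Finset.induction_on with
  | empty => simp [compCount_empty]
  | insert e A he ih =>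
    induction e with
    | h x y =>
      have hA' := ih (hA.mono (by simp))
      have hxy : ¬ Conn (A : Set (Sym2 V)) x y := by
        intro h
        refine hA x y (by simp) (h.mono ?_)
        intro f hf
        refine ⟨by simp at hf ⊢; exact Or.inr hf, ?_⟩
        rintro rfl
        exact he hf
      rw [Finset.card_insert_of_notMem he, Finset.coe_insert, ← hA', ← compCount_insert hxy]
      ring

/-- The forest has `|V| - |A|` components, and those other than the component of `v` are at most as
many as the vertices outside it. -/
theorem card_supp_le {A : Finset (Sym2 V)} (hA : Acyc (A : Set (Sym2 V))) (v : V) :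
    (supp (A : Set (Sym2 V)) v).card ≤ A.card + 1 := by
  have h1 := compCount_add_card hA
  have h2 : compCount (A : Set (Sym2 V)) Finset.univ ≤
      1 + (Finset.univ \ supp (A : Set (Sym2 V)) v).card := by
    have : Finset.univ.image (supp (A : Set (Sym2 V))) ⊆
        {supp (A : Set (Sym2 V)) v} ∪
          (Finset.univ \ supp (A : Set (Sym2 V)) v).image (supp (A : Set (Sym2 V))) := by
      intro T hT
      obtain ⟨w, -, rfl⟩ := Finset.mem_image.1 hT
      by_cases hw : w ∈ supp (A : Set (Sym2 V)) v
      · exact Finset.mem_union_left _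
          (Finset.mem_singleton.2 (supp_eq_supp_iff.2 (mem_supp.1 hw).symm))
      · exact Finset.mem_union_right _ (Finset.mem_image_of_mem _ (by simp [hw]))
    refine (Finset.card_le_card this).trans ((Finset.card_union_le _ _).trans ?_)
    gcongr
    · simp
    · exact Finset.card_image_le
  have h3 : (Finset.univ \ supp (A : Set (Sym2 V)) v).card =
      Fintype.card V - (supp (A : Set (Sym2 V)) v).card := by
    rw [Finset.card_sdiff_of_subset (Finset.subset_univ _), Finset.card_univ]
  have h4 := Finset.card_le_univ (supp (A : Set (Sym2 V)) v)
  omega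

end Components

/-! ### Whitney's cancellation and independence of the edge order -/

section Whitney

variable {V : Type*} {G : SimpleGraph V} {r : Sym2 V → Sym2 V → Prop}

/-- The edge `e` closes a circuit with edges of `A` that precede it. -/
def Closes (r : Sym2 V → Sym2 V → Prop) (A : Set (Sym2 V)) (e : Sym2 V) : Prop :=
  ∃ x y, e = s(x, y) ∧ Conn {f ∈ A | r f e} x y

/-- Remove `e` from `A` if it is there and add it if it is not. -/
noncomputable def toggle (e : Sym2 V) (A : Finset (Sym2 V)) : Finset (Sym2 V) :=
  if e ∈ A then A.erase e else insert e A

theorem toggle_toggle (e : Sym2 V) (A : Finset (Sym2 V)) : toggle e (toggle e A) = A := by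
  by_cases h : e ∈ A <;> simp [toggle, h]

theorem mem_toggle_of_ne {e f : Sym2 V} (hf : f ≠ e) (A : Finset (Sym2 V)) :
    f ∈ toggle e A ↔ f ∈ A := by
  by_cases h : e ∈ A <;> simp [toggle, h, hf]

theorem neg_one_pow_card_toggle (e : Sym2 V) (A : Finset (Sym2 V)) :
    (-1 : ℂ) ^ (toggle e A).card = -(-1) ^ A.card := by
  by_cases h : e ∈ A
  · rw [toggle, if_pos h, ← Finset.card_erase_add_one h, pow_succ]
    ring
  · rw [toggle, if_neg h, Finset.card_insert_of_notMem h, pow_succ]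
    ring

/-- The circuit is witnessed by edges strictly before `e`, which the toggle leaves alone. -/
theorem Closes.toggle_self {E : Set (Sym2 V)} (hr : StrictTotalOn r E) {A : Finset (Sym2 V)}
    {e : Sym2 V} (heE : e ∈ E) (h : Closes r A e) : Closes r (toggle e A) e := by
  obtain ⟨x, y, rfl, hc⟩ := h
  refine ⟨x, y, rfl, hc.mono ?_⟩
  rintro f ⟨hf, hlt⟩
  refine ⟨?_, hlt⟩
  have hne : f ≠ s(x, y) := by
    rintro rfl
    exact hr.irrefl _ heE hlt
  exact (mem_toggle_of_ne hne A).2 hf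

/-- Toggling a closing edge does not create later closing edges. -/
theorem Closes.of_toggle {E : Set (Sym2 V)} (hr : StrictTotalOn r E) {A : Finset (Sym2 V)}
    (hA : ∀ f ∈ A, f ∈ E) {e e' : Sym2 V} (heE : e ∈ E) (heE' : e' ∈ E) (h : Closes r A e)
    (hlt : r e e') (h' : Closes r (toggle e A) e') : Closes r A e' := by
  obtain ⟨x, y, rfl, hc⟩ := h
  obtain ⟨x', y', rfl, hc'⟩ := h'
  refine ⟨x', y', rfl, hc'.lift ?_⟩
  rintro a b ⟨hab, hlt'⟩
  have hsub : {f | f ∈ (A : Set (Sym2 V)) ∧ r f s(x, y)} ⊆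
      {f | f ∈ (A : Set (Sym2 V)) ∧ r f s(x', y')} := by
    rintro f ⟨hf, hfe⟩
    exact ⟨hf, hr.trans _ (hA f hf) _ heE _ heE' hfe hlt⟩
  by_cases hne : s(a, b) = s(x, y)
  · rcases Sym2.eq_iff.1 hne with ⟨rfl, rfl⟩ | ⟨rfl, rfl⟩
    · exact hc.mono hsub
    · exact hc.symm.mono hsub
  · exact Conn.of_mem ⟨(mem_toggle_of_ne hne A).1 hab, hlt'⟩

variable [Fintype V]

/-- The finite set of the broken-circuit-free forests of `G`. -/
noncomputable def bcfSets (G : SimpleGraph V) (r : Sym2 V → Sym2 V → Prop) :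
    Finset (Finset (Sym2 V)) :=
  Finset.univ.filter fun A : Finset (Sym2 V) => IsBCFForest G r (A : Set (Sym2 V))

theorem mem_bcfSets {A : Finset (Sym2 V)} :
    A ∈ bcfSets G r ↔ IsBCFForest G r (A : Set (Sym2 V)) := by simp [bcfSets]

theorem genFun_eq (z : ℂ) : genFun G r z = ∑ A ∈ bcfSets G r, z ^ A.card := rfl

/-- The ends of a closing edge are connected without it, so its presence does not affect the
partition. -/
theorem Closes.supp_toggle {E : Set (Sym2 V)} (hr : StrictTotalOn r E) {A : Finset (Sym2 V)}
    {e : Sym2 V} (heE : e ∈ E) (h : Closes r A e) :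
    supp (toggle e A : Set (Sym2 V)) = supp (A : Set (Sym2 V)) := by
  obtain ⟨x, y, rfl, hc⟩ := h
  by_cases he : s(x, y) ∈ A
  · rw [toggle, if_pos he]
    conv_rhs => rw [← Finset.insert_erase he]
    rw [Finset.coe_insert (s(x, y)) (A.erase s(x, y)), supp_insert_of_conn]
    refine hc.mono ?_
    rintro f ⟨hf, hlt⟩
    simp only [Finset.coe_erase, Set.mem_sdiff, Set.mem_singleton_iff]
    refine ⟨hf, ?_⟩
    rintro rfl
    exact hr.irrefl _ heE hlt
  · rw [toggle, if_neg he, Finset.coe_insert, supp_insert_of_conn]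
    exact hc.mono fun f hf => hf.1

/-- Whitney's broken circuit theorem, for an arbitrary weight of the partition into components. -/
theorem sum_bcfSets_eq_sum_subsets (hr : StrictTotalOn r G.edgeSet) (φ : (V → Finset V) → ℂ) :
    ∑ A ∈ bcfSets G r, (-1) ^ A.card * φ (supp (A : Set (Sym2 V))) =
      ∑ A ∈ Finset.univ.filter (fun A : Finset (Sym2 V) => (A : Set (Sym2 V)) ⊆ G.edgeSet),
        (-1) ^ A.card * φ (supp (A : Set (Sym2 V))) := by
  set P := Finset.univ.filter (fun A : Finset (Sym2 V) => (A : Set (Sym2 V)) ⊆ G.edgeSet)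
  -- The pivot of the sign-reversing involution: the largest edge that closes a circuit with earlier
  -- edges of `A`. One exists because `A` is not a BCF forest.
  have hcl : ∀ A ∈ P.filter (fun A : Finset (Sym2 V) => ¬ IsBCFForest G r (A : Set (Sym2 V))),
      ∃ e ∈ G.edgeSet, Closes r A e ∧
        ∀ e' ∈ G.edgeSet, Closes r A e' → e' ≠ e → r e' e := by
    intro A hA
    simp only [P, Finset.mem_filter, Finset.mem_univ, true_and] at hA
    obtain ⟨hAE, hnot⟩ := hA
    rw [isBCFForest_iff hr] at hnot
    push Not at hnot
    obtain ⟨x, y, hxy, hc⟩ := hnot hAE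
    obtain ⟨e, he, hmax⟩ := hr.exists_max
      (Finset.univ.filter fun e => e ∈ G.edgeSet ∧ Closes r A e)
      ⟨s(x, y), by simpa using ⟨hxy, x, y, rfl, hc⟩⟩
      (fun e he => by simpa using (Finset.mem_filter.1 he).2.1)
    simp only [Finset.mem_filter, Finset.mem_univ, true_and] at he hmax
    exact ⟨e, he.1, he.2, fun e' h1 h2 h3 => hmax e' ⟨h1, h2⟩ h3⟩
  choose m hmE hmC hmmax using hcl
  have hPE : ∀ A ∈ P.filter (fun A : Finset (Sym2 V) => ¬ IsBCFForest G r (A : Set (Sym2 V))),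
      ∀ f ∈ A, f ∈ G.edgeSet := by
    intro A hA f hf
    simp only [P, Finset.mem_filter, Finset.mem_univ, true_and] at hA
    exact hA.1 hf
  have hmem : ∀ (A) (hA : A ∈ P.filter
      (fun A : Finset (Sym2 V) => ¬ IsBCFForest G r (A : Set (Sym2 V)))),
      toggle (m A hA) A ∈ P.filter (fun A : Finset (Sym2 V) => ¬ IsBCFForest G r (A : Set (Sym2 V))) := by
    intro A hA
    have hsub : (toggle (m A hA) A : Set (Sym2 V)) ⊆ G.edgeSet := by
      intro f hf
      by_cases hfm : f = m A hA
      · rw [hfm]; exact hmE A hA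
      · exact hPE A hA f ((mem_toggle_of_ne hfm A).1 hf)
    simp only [P, Finset.mem_filter, Finset.mem_univ, true_and]
    refine ⟨hsub, fun hB => ?_⟩
    rw [isBCFForest_iff hr] at hB
    obtain ⟨x, y, hxy, hc⟩ := (hmC A hA).toggle_self hr (hmE A hA)
    have hmE' := hmE A hA
    rw [hxy] at hmE' hc
    exact hB.2 x y hmE' (by rw [hxy]; exact hc)
  have hzero : ∑ A ∈ P.filter (fun A : Finset (Sym2 V) => ¬ IsBCFForest G r (A : Set (Sym2 V))),
      (-1) ^ A.card * φ (supp (A : Set (Sym2 V))) = 0 := by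
    refine Finset.sum_involution (fun A hA => toggle (m A hA) A) ?_ ?_ hmem ?_
    · intro A hA
      rw [neg_one_pow_card_toggle, (hmC A hA).supp_toggle hr (hmE A hA)]
      ring
    · intro A hA _ heq
      have := congrArg (m A hA ∈ ·) heq
      by_cases h : m A hA ∈ A <;> simp [toggle, h] at this
    · intro A hA
      have hB := hmem A hA
      -- The pivot survives the toggle: it still closes a circuit, and a larger edge closing one
      -- afterwards would already have closed one in `A`.
      have : m (toggle (m A hA) A) hB = m A hA := by
        by_contra hne
        have h1 := hmmax _ hB _ (hmE A hA) ((hmC A hA).toggle_self hr (hmE A hA)) (Ne.symm hne)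
        have h2 := (hmC A hA).of_toggle hr (hPE A hA) (hmE A hA) (hmE _ hB) h1 (hmC _ hB)
        have h3 := hmmax A hA _ (hmE _ hB) h2 hne
        exact hr.asymm (hmE A hA) (hmE _ hB) h1 h3
      simp only [this, toggle_toggle]
  rw [← Finset.sum_filter_add_sum_filter_not P
    (fun A : Finset (Sym2 V) => IsBCFForest G r (A : Set (Sym2 V))), hzero, add_zero]
  refine Finset.sum_congr ?_ fun _ _ => rfl
  ext A
  simp only [P, bcfSets, Finset.mem_filter, Finset.mem_univ, true_and]
  exact ⟨fun h => ⟨h.1, h⟩, fun h => h.2⟩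

/-- The generating function of the broken-circuit-free forests does not depend on the order. -/
theorem genFun_order_independent {r' : Sym2 V → Sym2 V → Prop} (hr : StrictTotalOn r G.edgeSet)
    (hr' : StrictTotalOn r' G.edgeSet) (z : ℂ) : genFun G r z = genFun G r' z := by
  -- On a forest the exponent is `|A|`, so the sign times this weight is `z ^ |A|`, although the
  -- weight sees only the partition.
  let φ : (V → Finset V) → ℂ := fun s =>
    (-z) ^ (Fintype.card V - (Finset.univ.image s).card)
  have key : ∀ ρ : Sym2 V → Sym2 V → Prop, genFun G ρ z =
      ∑ A ∈ bcfSets G ρ, (-1) ^ A.card * φ (supp (A : Set (Sym2 V))) := by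
    intro ρ
    rw [genFun_eq]
    refine Finset.sum_congr rfl fun A hA => ?_
    have h : compCount (A : Set (Sym2 V)) Finset.univ + A.card = Fintype.card V :=
      compCount_add_card (mem_bcfSets.1 hA).acyc
    have h' : Fintype.card V - (Finset.univ.image (supp (A : Set (Sym2 V)))).card = A.card := by
      rw [compCount] at h
      omega
    simp only [φ, h']
    rw [← mul_pow]
    simp
  rw [key, key, sum_bcfSets_eq_sum_subsets hr, sum_bcfSets_eq_sum_subsets hr']

end Whitney

/-! ### Expansion of the generating function at a vertex -/

section Star

variable {V : Type*} {G : SimpleGraph V} {r : Sym2 V → Sym2 V → Prop}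

theorem mem_edgeSet_restrict {U : Set V} {f : Sym2 V} :
    f ∈ (restrict G U).edgeSet ↔ f ∈ G.edgeSet ∧ ∀ w ∈ f, w ∈ U := by
  induction f with
  | h x y =>
    simp only [SimpleGraph.mem_edgeSet, Sym2.mem_iff, forall_eq_or_imp, forall_eq, restrict]
    tauto

/-- The order `r`, changed so that the edges at `u` come last. -/
def starOrder (r : Sym2 V → Sym2 V → Prop) (u : V) (f e : Sym2 V) : Prop :=
  (u ∉ f ∧ u ∈ e) ∨ ((u ∈ f ↔ u ∈ e) ∧ r f e)

theorem StrictTotalOn.starOrder {E : Set (Sym2 V)} (hr : StrictTotalOn r E) (u : V) :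
    StrictTotalOn (starOrder r u) E where
  irrefl e he := by
    have := hr.irrefl e he
    unfold BCF.starOrder
    tauto
  trans e he f hf g hg := by
    have := hr.trans e he f hf g hg
    unfold BCF.starOrder
    tauto
  total e he f hf hne := by
    have := hr.total e he f hf hne
    unfold BCF.starOrder
    tauto

/-- All edges avoiding `u` precede `us`, so the only order constraint on a path from `u` to `s`
concerns its first edge, once the path is shortened to leave `u` only once. -/
theorem conn_starOrder_iff {B : Set (Sym2 V)} {u s : V} (hus : u ≠ s) :
    Conn {f ∈ B | starOrder r u f s(u, s)} u s ↔
      ∃ t, s(u, t) ∈ B ∧ r s(u, t) s(u, s) ∧ Conn {f ∈ B | u ∉ f} t s := by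
  constructor
  · intro h
    obtain ⟨t, ht, hc⟩ := h.exists_first_step hus
    refine ⟨t, ht.1, ?_, hc.mono ?_⟩
    swap
    · rintro f ⟨hf, hu⟩
      exact ⟨hf.1, hu⟩
    have := ht.2
    simp [starOrder] at this
    exact this
  · rintro ⟨t, ht, hlt, hc⟩
    refine Conn.trans (Conn.of_mem ⟨ht, ?_⟩) (hc.mono ?_)
    · simp [starOrder, hlt]
    · rintro f ⟨hf, hu⟩
      exact ⟨hf, by simp [starOrder, hu]⟩

/-- Edges at `u` never precede an edge off `u`, so the condition at the latter involves `G - u`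
only. The condition at an edge `us` becomes the third clause. -/
theorem isBCFForest_starOrder_iff (hr : StrictTotalOn r G.edgeSet) {u : V} {B : Set (Sym2 V)} :
    IsBCFForest G (starOrder r u) B ↔
      B ⊆ G.edgeSet ∧ IsBCFForest (restrict G {u}ᶜ) r {f ∈ B | u ∉ f} ∧
        ∀ t, s(u, t) ∈ B → ∀ s, G.Adj u s → r s(u, t) s(u, s) →
          ¬ Conn {f ∈ B | u ∉ f} t s := by
  have hsub : (restrict G {u}ᶜ).edgeSet ⊆ G.edgeSet := fun f hf => (mem_edgeSet_restrict.1 hf).1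
  rw [isBCFForest_iff (hr.starOrder u), isBCFForest_iff (hr.mono hsub)]
  refine and_congr_right fun hB => ?_
  have heq : ∀ x y, x ≠ u → y ≠ u →
      {f | f ∈ {f | f ∈ B ∧ u ∉ f} ∧ r f s(x, y)} = {f ∈ B | starOrder r u f s(x, y)} := by
    intro x y hx hy
    ext f
    have : u ∉ s(x, y) := by simp [hx.symm, hy.symm]
    simp only [starOrder, this, Set.mem_ofPred_eq]
    tauto
  constructor
  · intro h
    refine And.intro (And.intro ?_ ?_) ?_
    · rintro f ⟨hf, hu⟩
      rw [mem_edgeSet_restrict]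
      refine ⟨hB hf, fun w hw => ?_⟩
      rintro rfl
      exact hu hw
    · rintro x y ⟨hx, hy, hxy⟩
      rw [heq x y hx hy]
      exact h x y hxy
    · intro t ht s hus hlt hc
      exact h u s hus ((conn_starOrder_iff hus.ne).2 ⟨t, ht, hlt, hc⟩)
  · rintro ⟨⟨-, h1⟩, h2⟩
    have h3 : ∀ s, G.Adj u s → ¬ Conn {f ∈ B | starOrder r u f s(u, s)} u s := by
      intro s hus hc
      obtain ⟨t, ht, hlt, hc⟩ := (conn_starOrder_iff hus.ne).1 hc
      exact h2 t ht s hus hlt hc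
    intro x y hxy
    by_cases hx : x = u
    · subst hx
      exact h3 y hxy
    by_cases hy : y = u
    · subst hy
      rw [Sym2.eq_swap, conn_comm]
      exact h3 x hxy.symm
    · rw [← heq x y hx hy]
      exact h1 x y ⟨hx, hy, hxy⟩

theorem one_add_pow_card (z : ℂ) (M : Finset V) :
    (1 + z) ^ M.card = ∑ S ∈ M.powerset, z ^ S.card := by
  have := Finset.sum_pow_mul_eq_add_pow z 1 M
  simp only [one_pow, mul_one] at this
  rw [this, add_comm]

variable [Fintype V]

/-- The neighbours of `u` that come last in their component of `A`. -/
noncomputable def lastNeighbors (G : SimpleGraph V) (r : Sym2 V → Sym2 V → Prop) (u : V)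
    (A : Set (Sym2 V)) : Finset V :=
  Finset.univ.filter fun t => G.Adj u t ∧ ∀ s, G.Adj u s → r s(u, t) s(u, s) → ¬ Conn A t s

/-- Each component meeting the neighbourhood of `u` has exactly one last neighbour. -/
theorem card_lastNeighbors (hr : StrictTotalOn r G.edgeSet) (u : V) (A : Set (Sym2 V)) :
    (lastNeighbors G r u A).card = compCount A (Finset.univ.filter (G.Adj u)) := by
  have himage : (lastNeighbors G r u A).image (supp A) =
      (Finset.univ.filter (G.Adj u)).image (supp A) := by
    apply subset_antisymm
    · apply Finset.image_subset_image
      intro t ht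
      simp only [lastNeighbors, Finset.mem_filter] at ht ⊢
      exact ⟨ht.1, ht.2.1⟩
    · intro T hT
      obtain ⟨t, ht, rfl⟩ := Finset.mem_image.1 hT
      simp only [Finset.mem_filter, Finset.mem_univ, true_and] at ht
      obtain ⟨e, he, hmax⟩ := hr.exists_max
        ((Finset.univ.filter fun s => G.Adj u s ∧ Conn A t s).image fun s => s(u, s))
        ⟨s(u, t), Finset.mem_image_of_mem _ (by simp [ht, Conn.refl])⟩
        (by
          intro e he
          obtain ⟨s, hs, rfl⟩ := Finset.mem_image.1 he
          exact (Finset.mem_filter.1 hs).2.1)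
      obtain ⟨s, hs, rfl⟩ := Finset.mem_image.1 he
      obtain ⟨-, hus, hts⟩ := Finset.mem_filter.1 hs
      refine Finset.mem_image.2 ⟨s, ?_, supp_eq_supp_iff.2 hts.symm⟩
      simp only [lastNeighbors, Finset.mem_filter, Finset.mem_univ, true_and]
      refine ⟨hus, fun s' hus' hlt hc => ?_⟩
      have hne : s(u, s') ≠ s(u, s) := by
        intro h
        rw [h] at hlt
        exact hr.irrefl _ hus hlt
      exact hr.asymm hus hus' hlt (hmax _ (Finset.mem_image_of_mem _
        (by simpa using ⟨hus', hts.trans hc⟩)) hne)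
  rw [compCount, ← himage, Finset.card_image_of_injOn]
  intro s hs t ht hst
  simp only [lastNeighbors, Finset.coe_filter, Finset.mem_univ, true_and, Set.mem_ofPred_eq]
    at hs ht
  have hc := supp_eq_supp_iff.1 hst
  by_contra hne
  rcases hr.total s(u, s) hs.1 s(u, t) ht.1 (fun h => hne (Sym2.congr_right.1 h)) with h | h
  · exact hs.2 t ht.1 h hc
  · exact ht.2 s hs.1 h hc.symm

/-- Expansion of the generating function at a vertex `u`: each component of a forest of `G - u`
that meets the neighbourhood of `u` is joined to `u` or not. -/
theorem genFun_eq_sum_restrict (hr : StrictTotalOn r G.edgeSet) (u : V) (z : ℂ) :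
    genFun G r z = ∑ A ∈ bcfSets (restrict G {u}ᶜ) r,
      z ^ A.card * (1 + z) ^ compCount (A : Set (Sym2 V)) (Finset.univ.filter (G.Adj u)) := by
  rw [genFun_order_independent hr (hr.starOrder u), genFun_eq]
  simp_rw [← card_lastNeighbors hr, one_add_pow_card, Finset.mul_sum]
  rw [Finset.sum_sigma']
  have hnu : ∀ A ∈ bcfSets (restrict G {u}ᶜ) r, ∀ f ∈ A, f ∈ G.edgeSet ∧ u ∉ f := by
    intro A hA f hf
    have := mem_edgeSet_restrict.1 ((mem_bcfSets.1 hA).1 hf)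
    exact ⟨this.1, fun hu => this.2 u hu rfl⟩
  have hinj : Function.Injective fun t : V => s(u, t) := fun a b h => Sym2.congr_right.1 h
  have hfilter : ∀ A ∈ bcfSets (restrict G {u}ᶜ) r, ∀ S : Finset V,
      {f | f ∈ ((A ∪ S.image fun t => s(u, t) : Finset (Sym2 V)) : Set (Sym2 V)) ∧ u ∉ f} =
        (A : Set (Sym2 V)) := by
    intro A hA S
    ext f
    simp only [Finset.coe_union, Finset.coe_image, Set.mem_ofPred_eq, Set.mem_union,
      Finset.mem_coe, Set.mem_image]
    constructor
    · rintro ⟨h | ⟨t, _, rfl⟩, hu⟩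
      · exact h
      · simp at hu
    · exact fun h => ⟨Or.inl h, (hnu A hA f h).2⟩
  have hmemS : ∀ A ∈ bcfSets (restrict G {u}ᶜ) r, ∀ (S : Finset V) (t : V),
      s(u, t) ∈ A ∪ S.image (fun t => s(u, t)) ↔ t ∈ S := by
    intro A hA S t
    rw [Finset.mem_union, hinj.mem_finset_image]
    refine ⟨fun h => h.resolve_left fun h => (hnu A hA _ h).2 (by simp), Or.inr⟩
  -- A forest `B` corresponds to its part off `u` and the set of far ends of its edges at `u`; the
  -- third clause of `isBCFForest_starOrder_iff` makes this an arbitrary set of last neighbours.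
  refine Finset.sum_bij' (fun B _ => ⟨B.filter (u ∉ ·), Finset.univ.filter (s(u, ·) ∈ B)⟩)
    (fun p _ => p.1 ∪ p.2.image fun t => s(u, t)) ?_ ?_ ?_ ?_ ?_
  · intro B hB
    rw [mem_bcfSets, isBCFForest_starOrder_iff hr] at hB
    rw [Finset.mem_sigma, mem_bcfSets, Finset.mem_powerset]
    have hco : ((B.filter (u ∉ ·) : Finset (Sym2 V)) : Set (Sym2 V)) =
        {f | f ∈ (B : Set (Sym2 V)) ∧ u ∉ f} := by
      ext f; simp
    simp only [hco]
    refine ⟨hB.2.1, fun t ht => ?_⟩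
    simp only [Finset.mem_filter, Finset.mem_univ, true_and] at ht
    simp only [lastNeighbors, Finset.mem_filter, Finset.mem_univ, true_and]
    exact ⟨hB.1 ht, hB.2.2 t ht⟩
  · rintro ⟨A, S⟩ hp
    obtain ⟨hA, hS⟩ := Finset.mem_sigma.1 hp
    simp only at hA hS
    rw [Finset.mem_powerset] at hS
    rw [mem_bcfSets, isBCFForest_starOrder_iff hr, hfilter A hA S]
    refine ⟨?_, mem_bcfSets.1 hA, ?_⟩
    · intro f hf
      rcases Finset.mem_union.1 hf with hf | hf
      · exact (hnu A hA f hf).1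
      · obtain ⟨t, ht, rfl⟩ := Finset.mem_image.1 hf
        exact (Finset.mem_filter.1 (hS ht)).2.1
    · intro t ht
      exact (Finset.mem_filter.1 (hS ((hmemS A hA S t).1 ht))).2.2
  · intro B hB
    have hBE := (mem_bcfSets.1 hB).1
    ext f
    simp only [Finset.mem_union, Finset.mem_filter, Finset.mem_image, Finset.mem_univ, true_and]
    constructor
    · rintro (h | ⟨t, ht, rfl⟩)
      exacts [h.1, ht]
    · intro hf
      by_cases hu : u ∈ f
      · obtain ⟨t, rfl⟩ := Sym2.mem_iff_exists.1 hu
        exact Or.inr ⟨t, hf, rfl⟩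
      · exact Or.inl ⟨hf, hu⟩
  · rintro ⟨A, S⟩ hp
    obtain ⟨hA, hS⟩ := Finset.mem_sigma.1 hp
    simp only at hA hS
    have h1 : (A ∪ S.image fun t => s(u, t)).filter (u ∉ ·) = A := by
      have := hfilter A hA S
      ext f
      have := congrArg (f ∈ ·) this
      simpa using this
    have h2 : Finset.univ.filter (s(u, ·) ∈ A ∪ S.image fun t => s(u, t)) = S := by
      ext t
      rw [Finset.mem_filter, hmemS A hA S t]
      simp
    simp only [h1, h2]
  · intro B hB
    simp only
    rw [← pow_add]
    congr 1
    rw [← Finset.card_filter_add_card_filter_not (s := B) (u ∉ ·)]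
    congr 1
    rw [← Finset.card_image_of_injective (Finset.univ.filter (s(u, ·) ∈ B)) hinj]
    congr 1
    ext f
    simp only [Finset.mem_filter, not_not, Finset.mem_image, Finset.mem_univ, true_and]
    constructor
    · rintro ⟨hf, hu⟩
      obtain ⟨t, rfl⟩ := Sym2.mem_iff_exists.1 hu
      exact ⟨t, hf, rfl⟩
    · rintro ⟨t, ht, rfl⟩
      exact ⟨ht, by simp⟩

end Star

/-! ### Splitting off the tree that contains a vertex -/

section Recursion

variable {V : Type*} {G : SimpleGraph V} {r : Sym2 V → Sym2 V → Prop}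

theorem edgeSet_restrict_subset (G : SimpleGraph V) (U : Set V) :
    (restrict G U).edgeSet ⊆ G.edgeSet := fun _ hf => (mem_edgeSet_restrict.1 hf).1

theorem restrict_restrict (G : SimpleGraph V) (U W : Set V) :
    restrict (restrict G U) W = restrict G (U ∩ W) := by
  ext x y
  simp only [restrict, Set.mem_inter_iff]
  tauto

theorem restrict_univ (G : SimpleGraph V) : restrict G Set.univ = G := by
  ext x y
  simp [restrict]

theorem IsBCFForest.subset (hr : StrictTotalOn r G.edgeSet) {A B : Set (Sym2 V)}
    (h : IsBCFForest G r B) (hAB : A ⊆ B) : IsBCFForest G r A := by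
  rw [isBCFForest_iff hr] at h ⊢
  refine ⟨hAB.trans h.1, fun x y hxy hc => h.2 x y hxy (hc.mono ?_)⟩
  rintro f ⟨hf, hlt⟩
  exact ⟨hAB hf, hlt⟩

theorem IsBCFForest.restrict (hr : StrictTotalOn r G.edgeSet) {A : Set (Sym2 V)} {U : Set V}
    (h : IsBCFForest G r A) (hU : ∀ f ∈ A, ∀ w ∈ f, w ∈ U) :
    IsBCFForest (BCF.restrict G U) r A := by
  rw [isBCFForest_iff (hr.mono (edgeSet_restrict_subset G U))]
  rw [isBCFForest_iff hr] at h
  exact ⟨fun f hf => mem_edgeSet_restrict.2 ⟨h.1 hf, hU f hf⟩, fun x y hxy => h.2 x y hxy.2.2⟩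

/-- `A` is split into the set `T` of edges inside `S` and the set `B` of edges outside `S`. -/
structure Splits (A T B : Set (Sym2 V)) (S : Set V) : Prop where
  mem_iff : ∀ f, f ∈ A ↔ f ∈ T ∨ f ∈ B
  inside : ∀ f ∈ T, ∀ w ∈ f, w ∈ S
  outside : ∀ f ∈ B, ∀ w ∈ f, w ∉ S

theorem Splits.filter {A T B : Set (Sym2 V)} {S : Set V} (h : Splits A T B S)
    (p : Sym2 V → Prop) : Splits {f ∈ A | p f} {f ∈ T | p f} {f ∈ B | p f} S where
  mem_iff f := by
    have := h.mem_iff f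
    simp only [Set.mem_ofPred_eq]
    tauto
  inside f hf := h.inside f hf.1
  outside f hf := h.outside f hf.1

theorem Splits.conn_inside {A T B : Set (Sym2 V)} {S : Set V} (h : Splits A T B S) {x y : V}
    (hx : x ∈ S) (hc : Conn A x y) : Conn T x y ∧ y ∈ S := by
  refine hc.of_closed (P := fun w => w ∈ S) hx fun a b ha hab => ?_
  rcases (h.mem_iff _).1 hab with hT | hB
  · exact ⟨hT, h.inside _ hT b (Sym2.mem_mk_right a b)⟩
  · exact absurd ha (h.outside _ hB a (Sym2.mem_mk_left a b))

theorem Splits.conn_outside {A T B : Set (Sym2 V)} {S : Set V} (h : Splits A T B S) {x y : V}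
    (hx : x ∉ S) (hc : Conn A x y) : Conn B x y ∧ y ∉ S := by
  refine hc.of_closed (P := fun w => w ∉ S) hx fun a b ha hab => ?_
  rcases (h.mem_iff _).1 hab with hT | hB
  · exact absurd (h.inside _ hT a (Sym2.mem_mk_left a b)) ha
  · exact ⟨hB, h.outside _ hB b (Sym2.mem_mk_right a b)⟩

/-- No walk in `A` crosses the boundary of `S`, so each connectivity condition lives entirely in `T`
or entirely in `B`. -/
theorem Splits.isBCFForest (hr : StrictTotalOn r G.edgeSet) {A T B : Set (Sym2 V)} {S : Set V}
    (h : Splits A T B S) (hT : IsBCFForest G r T)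
    (hB : IsBCFForest (BCF.restrict G Sᶜ) r B) : IsBCFForest G r A := by
  rw [isBCFForest_iff hr] at hT ⊢
  rw [isBCFForest_iff (hr.mono (edgeSet_restrict_subset G Sᶜ))] at hB
  refine ⟨fun f hf => ?_, fun x y hxy hc => ?_⟩
  · rcases (h.mem_iff _).1 hf with hf | hf
    · exact hT.1 hf
    · exact edgeSet_restrict_subset _ _ (hB.1 hf)
  · have hs := h.filter (fun f => r f s(x, y))
    by_cases hx : x ∈ S
    · exact hT.2 x y hxy (hs.conn_inside hx hc).1
    · obtain ⟨h1, h2⟩ := hs.conn_outside hx hc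
      exact hB.2 x y ⟨hx, h2, hxy⟩ h1

/-- All edges of `T` are connected to the vertex `v`. -/
def Anchored (T : Set (Sym2 V)) (v : V) : Prop := ∀ f ∈ T, ∀ w ∈ f, Conn T v w

variable [Fintype V]

/-- The broken-circuit-free trees of `G` that contain the vertex `v`. -/
noncomputable def treeSets (G : SimpleGraph V) (r : Sym2 V → Sym2 V → Prop) (v : V) :
    Finset (Finset (Sym2 V)) :=
  (bcfSets G r).filter fun T : Finset (Sym2 V) => Anchored (T : Set (Sym2 V)) v

/-- The generating function of the broken-circuit-free forests in which every component that
meets `N` carries an additional weight `1 + z`. -/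
noncomputable def markedSum (G : SimpleGraph V) (r : Sym2 V → Sym2 V → Prop) (z : ℂ)
    (N : Finset V) : ℂ :=
  ∑ A ∈ bcfSets G r, z ^ A.card * (1 + z) ^ compCount (A : Set (Sym2 V)) N

theorem markedSum_empty (G : SimpleGraph V) (r : Sym2 V → Sym2 V → Prop) (z : ℂ) :
    markedSum G r z ∅ = genFun G r z := by
  simp [markedSum, genFun_eq, compCount]

theorem Splits.supp_outside {A T B : Set (Sym2 V)} {S : Set V} (h : Splits A T B S) {x : V}
    (hx : x ∉ S) : supp A x = supp B x := by
  ext y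
  rw [mem_supp, mem_supp]
  exact ⟨fun hc => (h.conn_outside hx hc).1, fun hc => hc.mono fun f hf => (h.mem_iff f).2
    (Or.inr hf)⟩

/-- The component of `v` is `supp T v` and counts once if it meets `N`; the remaining components are
those of `B`. -/
theorem Splits.compCount {A T B : Set (Sym2 V)} {v : V}
    (h : Splits A T B (supp T v : Set V)) (N : Finset V) :
    compCount A N = (if (supp T v ∩ N).Nonempty then 1 else 0) + compCount B (N \ supp T v) := by
  have hin : ∀ w ∈ supp T v, supp A w = supp A v := by
    intro w hw
    exact supp_eq_supp_iff.2 ((mem_supp.1 hw).symm.mono fun f hf => (h.mem_iff f).2 (Or.inl hf))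
  have h1 : (N \ supp T v).image (supp A) = (N \ supp T v).image (supp B) := by
    refine Finset.image_congr fun w hw => h.supp_outside ?_
    simpa using (Finset.mem_sdiff.1 hw).2
  have h2 : N.image (supp A) = (supp T v ∩ N).image (supp A) ∪ (N \ supp T v).image (supp A) := by
    rw [← Finset.image_union]
    congr 1
    ext w
    simp only [Finset.mem_union, Finset.mem_inter, Finset.mem_sdiff]
    tauto
  have hdisj : Disjoint ((supp T v ∩ N).image (supp A)) ((N \ supp T v).image (supp A)) := by
    rw [Finset.disjoint_left]
    intro X hX hX'
    obtain ⟨a, ha, rfl⟩ := Finset.mem_image.1 hX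
    obtain ⟨b, hb, hab⟩ := Finset.mem_image.1 hX'
    refine (h.conn_outside (x := b) (by simpa using (Finset.mem_sdiff.1 hb).2)
      (supp_eq_supp_iff.1 hab)).2 ?_
    exact (Finset.mem_inter.1 ha).1
  rw [BCF.compCount, h2, Finset.card_union_of_disjoint hdisj, h1, BCF.compCount]
  congr 1
  split_ifs with hne
  · have : (supp T v ∩ N).image (supp A) = {supp A v} := by
      apply Finset.eq_singleton_iff_nonempty_unique_mem.2
      refine ⟨hne.image _, fun X hX => ?_⟩
      obtain ⟨a, ha, rfl⟩ := Finset.mem_image.1 hX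
      exact hin a (Finset.mem_inter.1 ha).1
    rw [this, Finset.card_singleton]
  · rw [Finset.not_nonempty_iff_eq_empty.1 hne]
    rfl

/-- Expansion of the marked generating function according to the tree that contains `v`. -/
theorem markedSum_eq_sum_trees (hr : StrictTotalOn r G.edgeSet) (z : ℂ) (N : Finset V) (v : V) :
    markedSum G r z N = ∑ T ∈ treeSets G r v, z ^ T.card *
      ((if (supp (T : Set (Sym2 V)) v ∩ N).Nonempty then 1 + z else 1) *
        markedSum (restrict G (supp (T : Set (Sym2 V)) v : Set V)ᶜ) r z
          (N \ supp (T : Set (Sym2 V)) v)) := by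
  have hsplit : ∀ T ∈ treeSets G r v,
      ∀ B ∈ bcfSets (restrict G (supp (T : Set (Sym2 V)) v : Set V)ᶜ) r,
      Splits ((T ∪ B : Finset (Sym2 V)) : Set (Sym2 V)) T B
        (supp (T : Set (Sym2 V)) v : Set V) := by
    intro T hT B hB
    refine ⟨fun f => by simp, fun f hf w hw => ?_, fun f hf w hw => ?_⟩
    · exact mem_supp.2 ((Finset.mem_filter.1 hT).2 f hf w hw)
    · exact (mem_edgeSet_restrict.1 ((mem_bcfSets.1 hB).1 hf)).2 w hw
  have hdisj : ∀ T ∈ treeSets G r v,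
      ∀ B ∈ bcfSets (restrict G (supp (T : Set (Sym2 V)) v : Set V)ᶜ) r, Disjoint T B := by
    intro T hT B hB
    rw [Finset.disjoint_left]
    intro f hf hf'
    have hs := hsplit T hT B hB
    induction f with
    | h x y => exact hs.outside _ hf' x (by simp) (hs.inside _ hf x (by simp))
  simp_rw [markedSum, Finset.mul_sum]
  rw [Finset.sum_sigma']
  have hconn : ∀ A : Finset (Sym2 V), ∀ w, Conn (A : Set (Sym2 V)) v w →
      Conn (A.filter fun f => ∀ w ∈ f, Conn (A : Set (Sym2 V)) v w : Finset (Sym2 V)) v w := by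
    intro A w hw
    refine (hw.of_closed (P := fun w => Conn (A : Set (Sym2 V)) v w) (Conn.refl _ _) ?_).1
    intro x y hx hxy
    have hy := hx.trans (Conn.of_mem hxy)
    refine ⟨?_, hy⟩
    rw [Finset.mem_coe, Finset.mem_filter]
    refine ⟨hxy, fun w hw => ?_⟩
    rcases Sym2.mem_iff.1 hw with rfl | rfl
    exacts [hx, hy]
  have hsupp : ∀ A : Finset (Sym2 V),
      supp (A.filter fun f => ∀ w ∈ f, Conn (A : Set (Sym2 V)) v w : Finset (Sym2 V)) v =
        supp (A : Set (Sym2 V)) v := by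
    intro A
    ext w
    rw [mem_supp, mem_supp]
    exact ⟨fun h => h.mono (Finset.coe_subset.2 (Finset.filter_subset _ _)), hconn A w⟩
  refine Finset.sum_bij'
    (fun A _ => ⟨A.filter fun f => ∀ w ∈ f, Conn (A : Set (Sym2 V)) v w,
      A.filter fun f => ¬ ∀ w ∈ f, Conn (A : Set (Sym2 V)) v w⟩)
    (fun p _ => p.1 ∪ p.2) ?_ ?_ ?_ ?_ ?_
  · intro A hA
    rw [mem_bcfSets] at hA
    rw [Finset.mem_sigma]
    constructor
    · rw [treeSets, Finset.mem_filter, mem_bcfSets]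
      refine ⟨hA.subset hr (Finset.coe_subset.2 (Finset.filter_subset _ _)), fun f hf w hw => hconn A w ?_⟩
      exact (Finset.mem_filter.1 hf).2 w hw
    · simp only [hsupp]
      rw [mem_bcfSets]
      refine (hA.subset hr (Finset.coe_subset.2 (Finset.filter_subset _ _))).restrict hr ?_
      intro f hf w hw hwS
      obtain ⟨hf, hn⟩ := Finset.mem_filter.1 hf
      apply hn
      intro w' hw'
      have hwS' : Conn (A : Set (Sym2 V)) v w := mem_supp.1 hwS
      induction f with
      | h x y =>
        rcases Sym2.mem_iff.1 hw with rfl | rfl <;> rcases Sym2.mem_iff.1 hw' with rfl | rfl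
        · exact hwS'
        · exact hwS'.trans (Conn.of_mem hf)
        · exact hwS'.trans (Conn.of_mem hf).symm
        · exact hwS'
  · rintro ⟨T, B⟩ hp
    obtain ⟨hT, hB⟩ := Finset.mem_sigma.1 hp
    rw [mem_bcfSets]
    exact (hsplit T hT B hB).isBCFForest hr (mem_bcfSets.1 (Finset.mem_filter.1 hT).1)
      (mem_bcfSets.1 hB)
  · intro A hA
    exact Finset.filter_union_filter_not_eq _ _
  · rintro ⟨T, B⟩ hp
    obtain ⟨hT, hB⟩ := Finset.mem_sigma.1 hp
    simp only at hT hB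
    have hs := hsplit T hT B hB
    have hmem : ∀ f ∈ T ∪ B,
        ((∀ w ∈ f, Conn ((T ∪ B : Finset (Sym2 V)) : Set (Sym2 V)) v w) ↔ f ∈ T) := by
      intro f hf
      constructor
      · intro h
        refine (Finset.mem_union.1 hf).resolve_right fun hB' => ?_
        induction f with
        | h x y =>
          exact hs.outside _ hB' x (by simp)
            (hs.conn_inside (self_mem_supp _ v) (h x (by simp))).2
      · intro h w hw
        refine ((Finset.mem_filter.1 hT).2 f h w hw).mono (by simp)
    have h1 : (T ∪ B).filter
        (fun f => ∀ w ∈ f, Conn ((T ∪ B : Finset (Sym2 V)) : Set (Sym2 V)) v w) = T := by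
      rw [Finset.filter_congr hmem]
      ext f
      simp only [Finset.mem_filter, Finset.mem_union]
      tauto
    have h2 : (T ∪ B).filter
        (fun f => ¬ ∀ w ∈ f, Conn ((T ∪ B : Finset (Sym2 V)) : Set (Sym2 V)) v w) = B := by
      rw [Finset.filter_congr fun f hf => not_congr (hmem f hf)]
      ext f
      have : f ∈ B → f ∉ T := fun h => Finset.disjoint_right.1 (hdisj T hT B hB) h
      simp only [Finset.mem_filter, Finset.mem_union]
      tauto
    simp only [h1, h2]
  · intro A hA
    have hs : Splits (A : Set (Sym2 V))
        (A.filter fun f => ∀ w ∈ f, Conn (A : Set (Sym2 V)) v w : Finset (Sym2 V))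
        (A.filter fun f => ¬ ∀ w ∈ f, Conn (A : Set (Sym2 V)) v w : Finset (Sym2 V))
        (supp (A.filter fun f => ∀ w ∈ f, Conn (A : Set (Sym2 V)) v w : Finset (Sym2 V)) v :
          Set V) := by
      rw [hsupp]
      refine ⟨fun f => ?_, fun f hf w hw => ?_, fun f hf w hw hwS => ?_⟩
      · simp only [Finset.mem_coe, Finset.mem_filter]
        tauto
      · exact mem_supp.2 ((Finset.mem_filter.1 hf).2 w hw)
      · obtain ⟨hf, hn⟩ := Finset.mem_filter.1 hf
        apply hn
        intro w' hw'
        have hwS' : Conn (A : Set (Sym2 V)) v w := mem_supp.1 hwS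
        induction f with
        | h x y =>
          rcases Sym2.mem_iff.1 hw with rfl | rfl <;> rcases Sym2.mem_iff.1 hw' with rfl | rfl
          · exact hwS'
          · exact hwS'.trans (Conn.of_mem hf)
          · exact hwS'.trans (Conn.of_mem hf).symm
          · exact hwS'
    rw [hs.compCount N, pow_add]
    conv_lhs => rw [← Finset.card_filter_add_card_filter_not (s := A)
      (fun f => ∀ w ∈ f, Conn (A : Set (Sym2 V)) v w), pow_add]
    split_ifs <;> ring

end Recursion

/-! ### Weighted sums over trees through one or two vertices -/

section TreeSums

variable {V : Type*}

/-- The trees with edges in `D` that contain the vertex `v`, as sets of edges. -/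
noncomputable def anchoredTrees (D : Finset (Sym2 V)) (v : V) : Finset (Finset (Sym2 V)) :=
  D.powerset.filter fun T : Finset (Sym2 V) =>
    Acyc (T : Set (Sym2 V)) ∧ Anchored (T : Set (Sym2 V)) v

theorem mem_anchoredTrees {D T : Finset (Sym2 V)} {v : V} :
    T ∈ anchoredTrees D v ↔
      T ⊆ D ∧ Acyc (T : Set (Sym2 V)) ∧ Anchored (T : Set (Sym2 V)) v := by
  simp [anchoredTrees]

/-- The sum of `x ^ |T|` over the trees `T` in `D` that contain `v`. -/
noncomputable def treeSum (x : ℝ) (D : Finset (Sym2 V)) (v : V) : ℝ :=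
  ∑ T ∈ anchoredTrees D v, x ^ T.card

/-- The sum of `x ^ |T|` over the trees `T` in `D` that contain `v` and `w`. -/
noncomputable def pairSum (x : ℝ) (D : Finset (Sym2 V)) (v w : V) : ℝ :=
  ∑ T ∈ (anchoredTrees D v).filter (fun T : Finset (Sym2 V) => Conn (T : Set (Sym2 V)) v w),
    x ^ T.card

/-- The edges of `D` that do not contain `v`. -/
noncomputable def delVert (D : Finset (Sym2 V)) (v : V) : Finset (Sym2 V) := D.filter (v ∉ ·)

/-- The number of edges of `D` that contain `v`. -/
noncomputable def edgeDeg (D : Finset (Sym2 V)) (v : V) : ℕ := (D.filter (v ∈ ·)).card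

theorem treeSum_nonneg {x : ℝ} (hx : 0 ≤ x) (D : Finset (Sym2 V)) (v : V) :
    0 ≤ treeSum x D v := Finset.sum_nonneg fun _ _ => pow_nonneg hx _

theorem pairSum_nonneg {x : ℝ} (hx : 0 ≤ x) (D : Finset (Sym2 V)) (v w : V) :
    0 ≤ pairSum x D v w := Finset.sum_nonneg fun _ _ => pow_nonneg hx _

theorem pairSum_self (x : ℝ) (D : Finset (Sym2 V)) (v : V) :
    pairSum x D v v = treeSum x D v := by
  rw [pairSum, treeSum, Finset.filter_true_of_mem fun T _ => Conn.refl _ v]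

theorem edgeDeg_mono {D D' : Finset (Sym2 V)} (h : D ⊆ D') (v : V) :
    edgeDeg D v ≤ edgeDeg D' v := Finset.card_le_card (Finset.filter_subset_filter _ h)

theorem edgeDeg_erase {D : Finset (Sym2 V)} {e : Sym2 V} {v : V} (he : e ∈ D) (hv : v ∈ e) :
    edgeDeg (D.erase e) v + 1 = edgeDeg D v := by
  rw [edgeDeg, edgeDeg, Finset.filter_erase]
  exact Finset.card_erase_add_one (Finset.mem_filter.2 ⟨he, hv⟩)

theorem edgeDeg_delVert {D : Finset (Sym2 V)} {v s : V} (h : s(v, s) ∈ D) :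
    edgeDeg (delVert D v) s + 1 ≤ edgeDeg D s := by
  rw [← edgeDeg_erase h (Sym2.mem_mk_right v s)]
  gcongr
  refine edgeDeg_mono ?_ s
  intro f hf
  obtain ⟨hf, hv⟩ := Finset.mem_filter.1 hf
  refine Finset.mem_erase.2 ⟨?_, hf⟩
  rintro rfl
  exact hv (by simp)

theorem card_delVert_lt {D : Finset (Sym2 V)} {v s : V} (h : s(v, s) ∈ D) :
    (delVert D v).card < D.card := by
  refine Finset.card_lt_card ((Finset.filter_ssubset).2 ⟨_, h, ?_⟩)
  simp

/-- The part of `T` beyond the edge `e`, on the side of its end `s`. -/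
noncomputable def branch (T : Finset (Sym2 V)) (e : Sym2 V) (s : V) : Finset (Sym2 V) :=
  (T.erase e).filter fun f => ∀ w ∈ f, Conn (T.erase e : Set (Sym2 V)) s w

/-- The part of `T` before the edge `e`, seen from the end `s` of `e`. -/
noncomputable def trunk (T : Finset (Sym2 V)) (e : Sym2 V) (s : V) : Finset (Sym2 V) :=
  (T.erase e).filter fun f => ¬ ∀ w ∈ f, Conn (T.erase e : Set (Sym2 V)) s w

theorem trunk_union_branch (T : Finset (Sym2 V)) (e : Sym2 V) (s : V) :
    trunk T e s ∪ branch T e s = T.erase e := by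
  rw [Finset.union_comm]
  exact Finset.filter_union_filter_not_eq _ _

theorem card_trunk_add_card_branch (T : Finset (Sym2 V)) (e : Sym2 V) (s : V) :
    (trunk T e s).card + (branch T e s).card = (T.erase e).card := by
  rw [add_comm]
  exact Finset.card_filter_add_card_filter_not _

theorem conn_branch {T : Finset (Sym2 V)} {e : Sym2 V} {s w : V}
    (h : Conn (T.erase e : Set (Sym2 V)) s w) : Conn (branch T e s : Set (Sym2 V)) s w := by
  refine (h.of_closed (P := fun w => Conn (T.erase e : Set (Sym2 V)) s w) (Conn.refl _ _) ?_).1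
  intro x y hx hxy
  have hy := hx.trans (Conn.of_mem hxy)
  refine ⟨?_, hy⟩
  rw [Finset.mem_coe, branch, Finset.mem_filter]
  refine ⟨Finset.mem_coe.1 hxy, fun w hw => ?_⟩
  rcases Sym2.mem_iff.1 hw with rfl | rfl
  exacts [hx, hy]

theorem not_conn_erase {T : Finset (Sym2 V)} {v s : V} (hT : Acyc (T : Set (Sym2 V)))
    (h : s(v, s) ∈ T) : ¬ Conn (T.erase s(v, s) : Set (Sym2 V)) v s := by
  rw [Finset.coe_erase]
  exact hT v s h

/-- Cutting `vs` separates `s` from `v` in the tree, so the part on the side of `s` has no edge at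
`v`. -/
theorem branch_mem_anchoredTrees {D T : Finset (Sym2 V)} {v s : V} (hT : T ∈ anchoredTrees D v)
    (h : s(v, s) ∈ T) : branch T s(v, s) s ∈ anchoredTrees (delVert D v) s := by
  obtain ⟨hD, hacyc, -⟩ := mem_anchoredTrees.1 hT
  have hsub : branch T s(v, s) s ⊆ T := (Finset.filter_subset _ _).trans (Finset.erase_subset _ _)
  refine mem_anchoredTrees.2 ⟨fun f hf => ?_, hacyc.mono (by exact_mod_cast hsub),
    fun f hf w hw => ?_⟩
  · refine Finset.mem_filter.2 ⟨hD (hsub hf), fun hv => ?_⟩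
    exact not_conn_erase hacyc h ((Finset.mem_filter.1 hf).2 v hv).symm
  · exact conn_branch ((Finset.mem_filter.1 hf).2 w hw)

/-- An edge not on the side of `s` must be reached from `v` without using `vs`. -/
theorem trunk_mem_anchoredTrees {D T : Finset (Sym2 V)} {v s : V} (hT : T ∈ anchoredTrees D v)
    (h : s(v, s) ∈ T) : trunk T s(v, s) s ∈ anchoredTrees (D.erase s(v, s)) v := by
  obtain ⟨hD, hacyc, hanch⟩ := mem_anchoredTrees.1 hT
  have hnc := not_conn_erase hacyc h
  have hsub : trunk T s(v, s) s ⊆ T.erase s(v, s) := Finset.filter_subset _ _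
  refine mem_anchoredTrees.2 ⟨hsub.trans (Finset.erase_subset_erase _ hD),
    hacyc.mono (by exact_mod_cast hsub.trans (Finset.erase_subset _ _)), fun f hf w hw => ?_⟩
  obtain ⟨hfT, hfn⟩ := Finset.mem_filter.1 hf
  have h1 := hanch f (Finset.mem_of_mem_erase hfT) w hw
  rw [← Finset.insert_erase h, Finset.coe_insert s(v, s) (T.erase s(v, s)), conn_insert_iff] at h1
  have h2 : Conn (T.erase s(v, s) : Set (Sym2 V)) v w := by
    rcases h1 with h1 | ⟨-, h1⟩ | ⟨h1, -⟩
    · exact h1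
    · exfalso
      apply hfn
      intro w' hw'
      refine h1.trans ?_
      induction f with
      | h x y =>
        have hxy : Conn (T.erase s(v, s) : Set (Sym2 V)) x y := Conn.of_mem hfT
        rcases Sym2.mem_iff.1 hw with rfl | rfl <;> rcases Sym2.mem_iff.1 hw' with rfl | rfl
        exacts [Conn.refl _ _, hxy, hxy.symm, Conn.refl _ _]
    · exact absurd h1 hnc
  refine (h2.of_closed (P := fun w => Conn (T.erase s(v, s) : Set (Sym2 V)) v w)
    (Conn.refl _ _) ?_).1
  intro x y hx hxy
  refine ⟨?_, hx.trans (Conn.of_mem hxy)⟩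
  rw [Finset.mem_coe, trunk, Finset.mem_filter]
  exact ⟨Finset.mem_coe.1 hxy, fun hall => hnc (hx.trans (hall x (by simp)).symm)⟩

/-- A tree using `vs` is determined by its trunk and its branch at that edge. Only injectivity is
used, so pairs that do not recombine to a tree merely enlarge the bound. The condition `P` on the
branch lets the lemma serve `treeSum` and `pairSum` alike. -/
theorem sum_filter_branch_le {x : ℝ} (hx : 0 ≤ x) (D : Finset (Sym2 V)) (v s : V)
    (P : Finset (Sym2 V) → Prop) :
    ∑ T ∈ (anchoredTrees D v).filter (fun T => s(v, s) ∈ T ∧ P (branch T s(v, s) s)),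
        x ^ T.card ≤
      x * treeSum x (D.erase s(v, s)) v *
        ∑ B ∈ (anchoredTrees (delVert D v) s).filter P, x ^ B.card := by
  set F := (anchoredTrees D v).filter (fun T => s(v, s) ∈ T ∧ P (branch T s(v, s) s))
  have hF : ∀ T ∈ F, T ∈ anchoredTrees D v ∧ s(v, s) ∈ T ∧ P (branch T s(v, s) s) :=
    fun T hT => Finset.mem_filter.1 hT
  have hinj : Set.InjOn (fun T => (trunk T s(v, s) s, branch T s(v, s) s)) (F : Set _) := by
    intro T hT T' hT' heq
    simp only [Prod.mk.injEq] at heq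
    rw [← Finset.insert_erase (hF T hT).2.1, ← Finset.insert_erase (hF T' hT').2.1,
      ← trunk_union_branch T s(v, s) s, ← trunk_union_branch T' s(v, s) s, heq.1, heq.2]
  have h1 : ∑ T ∈ F, x ^ T.card =
      ∑ p ∈ F.image (fun T => (trunk T s(v, s) s, branch T s(v, s) s)),
        x * x ^ p.1.card * x ^ p.2.card := by
    rw [Finset.sum_image hinj]
    refine Finset.sum_congr rfl fun T hT => ?_
    rw [← Finset.card_erase_add_one (hF T hT).2.1, ← card_trunk_add_card_branch T s(v, s) s]
    ring
  have h2 : x * treeSum x (D.erase s(v, s)) v *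
        ∑ B ∈ (anchoredTrees (delVert D v) s).filter P, x ^ B.card =
      ∑ p ∈ anchoredTrees (D.erase s(v, s)) v ×ˢ (anchoredTrees (delVert D v) s).filter P,
        x * x ^ p.1.card * x ^ p.2.card := by
    rw [treeSum, mul_assoc, Finset.sum_mul_sum, Finset.mul_sum, Finset.sum_product]
    refine Finset.sum_congr rfl fun A _ => ?_
    rw [Finset.mul_sum]
    exact Finset.sum_congr rfl fun B _ => by ring
  rw [h1, h2]
  refine Finset.sum_le_sum_of_subset_of_nonneg ?_ fun _ _ _ => by positivity
  intro p hp
  obtain ⟨T, hT, rfl⟩ := Finset.mem_image.1 hp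
  obtain ⟨hT1, hT2, hT3⟩ := hF T hT
  exact Finset.mem_product.2 ⟨trunk_mem_anchoredTrees hT1 hT2,
    Finset.mem_filter.2 ⟨branch_mem_anchoredTrees hT1 hT2, hT3⟩⟩

/-- A tree either omits `vs`, giving the summand `1`, or is cut there, giving `x` times a branch at
`s`. -/
theorem treeSum_le_mul {x : ℝ} (hx : 0 ≤ x) (D : Finset (Sym2 V)) (v s : V) :
    treeSum x D v ≤ treeSum x (D.erase s(v, s)) v * (1 + x * treeSum x (delVert D v) s) := by
  have h1 := sum_filter_branch_le hx D v s (fun _ => True)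
  simp only [and_true, Finset.filter_true] at h1
  have h2 : ∑ T ∈ (anchoredTrees D v).filter (fun T => s(v, s) ∉ T), x ^ T.card ≤
      treeSum x (D.erase s(v, s)) v := by
    refine Finset.sum_le_sum_of_subset_of_nonneg ?_ fun _ _ _ => by positivity
    intro T hT
    obtain ⟨hT, hn⟩ := Finset.mem_filter.1 hT
    rw [mem_anchoredTrees] at hT ⊢
    exact ⟨Finset.subset_erase.2 ⟨hT.1, hn⟩, hT.2⟩
  rw [treeSum, ← Finset.sum_filter_add_sum_filter_not _ (fun T => s(v, s) ∈ T)]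
  refine (add_le_add h1 h2).trans (le_of_eq ?_)
  rw [← treeSum]
  ring

theorem exists_edge_of_mem_anchoredTrees {D T : Finset (Sym2 V)} {v : V}
    (hT : T ∈ anchoredTrees D v) (hne : T.Nonempty) : ∃ s, s(v, s) ∈ T := by
  obtain ⟨f, hf⟩ := hne
  induction f with
  | h a b =>
    have := (mem_anchoredTrees.1 hT).2.2 _ hf a (by simp)
    by_cases hva : v = a
    · exact ⟨b, hva ▸ hf⟩
    · obtain ⟨s, hs, -⟩ := this.exists_first_step hva
      exact ⟨s, hs⟩

/-- The trees that contain `v` in a graph of maximum degree `k + 1`. -/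
theorem treeSum_le_pow {x Y : ℝ} (hx : 0 ≤ x) (hY : 0 ≤ Y) {k : ℕ} (hxY : (1 + x * Y) ^ k ≤ Y)
    (D : Finset (Sym2 V)) (hD : ∀ w, edgeDeg D w ≤ k + 1) (v : V) :
    treeSum x D v ≤ (1 + x * Y) ^ edgeDeg D v := by
  induction hn : D.card using Nat.strong_induction_on generalizing D v with
  | _ n ih =>
    subst hn
    have h1 : 1 ≤ 1 + x * Y := by nlinarith [mul_nonneg hx hY]
    by_cases hdeg : edgeDeg D v = 0
    · rw [hdeg, pow_zero, treeSum]
      have : anchoredTrees D v ⊆ {∅} := by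
        intro T hT
        rw [Finset.mem_singleton]
        by_contra hne
        obtain ⟨s, hs⟩ := exists_edge_of_mem_anchoredTrees hT (Finset.nonempty_iff_ne_empty.2 hne)
        rw [edgeDeg, Finset.card_eq_zero] at hdeg
        have : s(v, s) ∈ D.filter (v ∈ ·) :=
          Finset.mem_filter.2 ⟨(mem_anchoredTrees.1 hT).1 hs, by simp⟩
        rw [hdeg] at this
        exact absurd this (Finset.notMem_empty _)
      refine (Finset.sum_le_sum_of_subset_of_nonneg this fun _ _ _ => by positivity).trans ?_
      simp
    · obtain ⟨e, he⟩ := Finset.card_pos.1 (Nat.pos_of_ne_zero hdeg)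
      obtain ⟨heD, hve⟩ := Finset.mem_filter.1 he
      obtain ⟨s, rfl⟩ := Sym2.mem_iff_exists.1 hve
      have hA := ih _ (Finset.card_erase_lt_of_mem heD) (D.erase s(v, s))
        (fun w => (edgeDeg_mono (Finset.erase_subset _ _) w).trans (hD w)) v rfl
      have hB := ih _ (card_delVert_lt heD) (delVert D v)
        (fun w => (edgeDeg_mono (Finset.filter_subset _ _) w).trans (hD w)) s rfl
      -- Deleting `v` takes an edge from `s`, leaving degree at most `k`, and the inequality for `Y`
      -- closes the recursion.
      have hB' : treeSum x (delVert D v) s ≤ Y := by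
        refine hB.trans ((pow_le_pow_right₀ h1 ?_).trans hxY)
        have := edgeDeg_delVert heD
        have := hD s
        omega
      rw [← edgeDeg_erase heD hve, pow_succ]
      refine (treeSum_le_mul hx D v s).trans ?_
      have := treeSum_nonneg hx (delVert D v) s
      gcongr

theorem treeSum_le {x Y : ℝ} (hx : 0 ≤ x) (hY : 0 ≤ Y) {k : ℕ} (hxY : (1 + x * Y) ^ k ≤ Y)
    {D : Finset (Sym2 V)} (hD : ∀ w, edgeDeg D w ≤ k + 1) {v : V} (hv : edgeDeg D v ≤ k) :
    treeSum x D v ≤ Y :=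
  (treeSum_le_pow hx hY hxY D hD v).trans
    ((pow_le_pow_right₀ (by nlinarith [mul_nonneg hx hY]) hv).trans hxY)

variable [Fintype V]

/-- The vertices joined to `v` by an edge of `D`. -/
noncomputable def edgeNbrs (D : Finset (Sym2 V)) (v : V) : Finset V :=
  Finset.univ.filter fun s => s(v, s) ∈ D

theorem mem_edgeNbrs {D : Finset (Sym2 V)} {v s : V} : s ∈ edgeNbrs D v ↔ s(v, s) ∈ D := by
  simp [edgeNbrs]

theorem card_edgeNbrs (D : Finset (Sym2 V)) (v : V) : (edgeNbrs D v).card = edgeDeg D v := by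
  have hinj : Function.Injective fun t : V => s(v, t) := fun a b h => Sym2.congr_right.1 h
  rw [edgeDeg, ← Finset.card_image_of_injective _ hinj]
  congr 1
  ext f
  simp only [Finset.mem_image, mem_edgeNbrs, Finset.mem_filter]
  constructor
  · rintro ⟨t, ht, rfl⟩
    exact ⟨ht, by simp⟩
  · rintro ⟨hf, hv⟩
    obtain ⟨t, rfl⟩ := Sym2.mem_iff_exists.1 hv
    exact ⟨t, hf, rfl⟩

/-- Expansion of the sum over the trees containing `v` and `w` at the first edge of the path
from `v` to `w`. -/
theorem pairSum_le_sum {x : ℝ} (hx : 0 ≤ x) (D : Finset (Sym2 V)) {v w : V} (hvw : v ≠ w) :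
    pairSum x D v w ≤ ∑ s ∈ edgeNbrs D v,
      x * treeSum x (D.erase s(v, s)) v * pairSum x (delVert D v) s w := by
  have h1 : ∀ s ∈ edgeNbrs D v, ∑ T ∈ (anchoredTrees D v).filter (fun T => s(v, s) ∈ T ∧
      Conn (branch T s(v, s) s : Set (Sym2 V)) s w), x ^ T.card ≤
      x * treeSum x (D.erase s(v, s)) v * pairSum x (delVert D v) s w := fun s _ =>
    sum_filter_branch_le hx D v s fun B => Conn (B : Set (Sym2 V)) s w
  -- After exchanging the sums, it suffices that each tree through `v` and `w` has some first edge
  -- `vs` whose branch contains `w`.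
  refine le_trans ?_ (Finset.sum_le_sum h1)
  simp_rw [pairSum, Finset.sum_filter]
  rw [Finset.sum_comm]
  refine Finset.sum_le_sum fun T hT => ?_
  have hnn : ∀ s ∈ edgeNbrs D v, 0 ≤ if s(v, s) ∈ T ∧
      Conn (branch T s(v, s) s : Set (Sym2 V)) s w then x ^ T.card else 0 := by
    intro s _
    split_ifs <;> positivity
  split_ifs with hc
  · obtain ⟨s, hs, hsw⟩ := hc.exists_first_step hvw
    have hcond : s(v, s) ∈ T ∧ Conn (branch T s(v, s) s : Set (Sym2 V)) s w := by
      refine ⟨hs, conn_branch (hsw.mono ?_)⟩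
      rintro f ⟨hf, hv⟩
      rw [Finset.coe_erase]
      refine ⟨hf, ?_⟩
      rintro rfl
      exact hv (by simp)
    have := Finset.single_le_sum hnn
      (mem_edgeNbrs.2 ((mem_anchoredTrees.1 hT).1 hs))
    rwa [if_pos hcond] at this
  · exact Finset.sum_nonneg hnn

/-- The trees that contain two vertices at distance at least `d`, in a graph of maximum degree
`k + 1`. -/
theorem pairSum_le {x Y q : ℝ} (hx : 0 ≤ x) (hY : 0 ≤ Y) {k : ℕ} (hk : 1 ≤ k)
    (hxY : (1 + x * Y) ^ k ≤ Y) (hq : q = x * Y / (1 + x * Y)) (hy : k * q < 1)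
    (D : Finset (Sym2 V)) (hloop : ∀ f ∈ D, ¬ f.IsDiag) (hD : ∀ w, edgeDeg D w ≤ k + 1)
    {v w : V} (hvw : v ≠ w) (hv : edgeDeg D v ≤ k) {d : ℕ} (hd : 1 ≤ d)
    (hdist : ∀ p : (SimpleGraph.fromEdgeSet (D : Set (Sym2 V))).Walk v w, d ≤ p.length) :
    pairSum x D v w ≤ Y / k * ((k * q) ^ d / (1 - k * q)) := by
  induction hn : D.card using Nat.strong_induction_on generalizing D v d with
  | _ n ih =>
    subst hn
    have hk0 : (0 : ℝ) < k := by exact_mod_cast hk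
    have hxY0 := mul_nonneg hx hY
    have h1 : 1 ≤ 1 + x * Y := by linarith
    have hq0 : 0 ≤ q := by rw [hq]; positivity
    have hy0 : 0 < 1 - k * q := by linarith
    have hdelsub : delVert D v ⊆ D := Finset.filter_subset _ _
    -- Without `vs` the degree of `v` is at most `k - 1`, which saves a factor `1 + x * Y`; this is
    -- the origin of `q`.
    have htrunk : ∀ s ∈ edgeNbrs D v, x * treeSum x (D.erase s(v, s)) v ≤ q := by
      intro s hs
      have hs := mem_edgeNbrs.1 hs
      have hle := treeSum_le_pow hx hY hxY (D.erase s(v, s))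
        (fun w => (edgeDeg_mono (Finset.erase_subset _ _) w).trans (hD w)) v
      have hdeg := edgeDeg_erase hs (Sym2.mem_mk_left v s)
      have hle' : treeSum x (D.erase s(v, s)) v * (1 + x * Y) ≤ Y :=
        calc treeSum x (D.erase s(v, s)) v * (1 + x * Y)
            ≤ (1 + x * Y) ^ edgeDeg (D.erase s(v, s)) v * (1 + x * Y) := by gcongr
          _ = (1 + x * Y) ^ edgeDeg D v := by rw [← hdeg, pow_succ]
          _ ≤ (1 + x * Y) ^ k := pow_le_pow_right₀ h1 hv
          _ ≤ Y := hxY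
      rw [hq, le_div_iff₀ (by linarith), mul_assoc]
      exact mul_le_mul_of_nonneg_left hle' hx
    -- A step lowers the distance bound by one, but not below `1` as long as `s ≠ w`, so `d' = 1` is
    -- available even for `d = 1`.
    have hrest : ∀ s ∈ edgeNbrs D v, s ≠ w → ∀ d' : ℕ, 1 ≤ d' → (d' = 1 ∨ d' + 1 ≤ d) →
        pairSum x (delVert D v) s w ≤ Y / k * ((k * q) ^ d' / (1 - k * q)) := by
      intro s hs hsw d' hd' hdd
      have hs := mem_edgeNbrs.1 hs
      refine ih _ (card_delVert_lt hs) (delVert D v) (fun f hf => hloop f (hdelsub hf))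
        (fun w => (edgeDeg_mono hdelsub w).trans (hD w)) hsw ?_ hd' ?_ rfl
      · have := edgeDeg_delVert hs
        have := hD s
        omega
      · intro p
        have hadj : (SimpleGraph.fromEdgeSet (D : Set (Sym2 V))).Adj v s :=
          ⟨hs, by simpa using hloop _ hs⟩
        have hle : SimpleGraph.fromEdgeSet (delVert D v : Set (Sym2 V)) ≤
            SimpleGraph.fromEdgeSet (D : Set (Sym2 V)) :=
          SimpleGraph.fromEdgeSet_mono (by exact_mod_cast hdelsub)
        have := hdist (SimpleGraph.Walk.cons hadj (p.mapLe hle))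
        simp only [SimpleGraph.Walk.length_cons, SimpleGraph.Walk.length_map,
          SimpleGraph.Walk.mapLe] at this
        have hpos : p.length ≠ 0 := fun h => hsw (SimpleGraph.Walk.eq_of_length_eq_zero h)
        omega
    have hcard : ((edgeNbrs D v).card : ℝ) ≤ k := by
      rw [card_edgeNbrs]; exact_mod_cast hv
    refine (pairSum_le_sum hx D hvw).trans ?_
    -- For `d = 1` one neighbour may be `w` itself and contributes `q * Y`. The bound reproduces
    -- itself because `1 + kq / (1 - kq) = 1 / (1 - kq)`.
    by_cases hd2 : d = 1
    · subst hd2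
      have hterm : ∀ s ∈ edgeNbrs D v,
          x * treeSum x (D.erase s(v, s)) v * pairSum x (delVert D v) s w ≤
            q * (Y / k * ((k * q) ^ 1 / (1 - k * q))) + if s = w then q * Y else 0 := by
        intro s hs
        have hp := pairSum_nonneg hx (delVert D v) s w
        have hc0 : 0 ≤ q * (Y / k * ((k * q) ^ 1 / (1 - k * q))) := by positivity
        split_ifs with hsw
        · subst hsw
          rw [pairSum_self] at hp ⊢
          have h2 : treeSum x (delVert D v) s ≤ Y := by
            refine treeSum_le hx hY hxY (fun w => (edgeDeg_mono hdelsub w).trans (hD w)) ?_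
            have := edgeDeg_delVert (mem_edgeNbrs.1 hs)
            have := hD s
            omega
          have := mul_le_mul (htrunk s hs) h2 hp hq0
          linarith
        · rw [add_zero]
          exact mul_le_mul (htrunk s hs) (hrest s hs hsw 1 le_rfl (Or.inl rfl)) hp hq0
      refine (Finset.sum_le_sum hterm).trans ?_
      rw [Finset.sum_add_distrib, Finset.sum_const, nsmul_eq_mul]
      have h3 : ∑ s ∈ edgeNbrs D v, (if s = w then q * Y else 0) ≤ q * Y := by
        rw [Finset.sum_ite_eq' (edgeNbrs D v) w]
        split_ifs <;> first | exact le_rfl | positivity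
      have h4 : ((edgeNbrs D v).card : ℝ) * (q * (Y / k * ((k * q) ^ 1 / (1 - k * q)))) ≤
          k * (q * (Y / k * ((k * q) ^ 1 / (1 - k * q)))) := by gcongr
      refine (add_le_add h4 h3).trans (le_of_eq ?_)
      field_simp
      ring
    · have hterm : ∀ s ∈ edgeNbrs D v,
          x * treeSum x (D.erase s(v, s)) v * pairSum x (delVert D v) s w ≤
            q * (Y / k * ((k * q) ^ (d - 1) / (1 - k * q))) := by
        intro s hs
        have hsw : s ≠ w := by
          rintro rfl
          have hs := mem_edgeNbrs.1 hs
          have hadj : (SimpleGraph.fromEdgeSet (D : Set (Sym2 V))).Adj v s :=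
            ⟨hs, by simpa using hloop _ hs⟩
          have := hdist (SimpleGraph.Walk.cons hadj SimpleGraph.Walk.nil)
          simp at this
          omega
        exact mul_le_mul (htrunk s hs) (hrest s hs hsw (d - 1) (by omega) (Or.inr (by omega)))
          (pairSum_nonneg hx _ _ _) hq0
      refine (Finset.sum_le_sum hterm).trans ?_
      rw [Finset.sum_const, nsmul_eq_mul]
      have h4 : ((edgeNbrs D v).card : ℝ) * (q * (Y / k * ((k * q) ^ (d - 1) / (1 - k * q)))) ≤
          k * (q * (Y / k * ((k * q) ^ (d - 1) / (1 - k * q)))) := by gcongr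
      refine h4.trans (le_of_eq ?_)
      obtain ⟨m, rfl⟩ : ∃ m, d = m + 1 := ⟨d - 1, by omega⟩
      rw [Nat.add_sub_cancel, pow_succ]
      ring

end TreeSums

/-! ### Error estimates and the induction over vertex sets -/

section Estimates

variable {V : Type*} [Fintype V] {G : SimpleGraph V} {r : Sym2 V → Sym2 V → Prop}

/-- Below `W₀`, the deletion of a vertex increases the generating function by a factor of at most
`1 / (1 - a)`. -/
def Stable (G : SimpleGraph V) (r : Sym2 V → Sym2 V → Prop) (z : ℂ) (a : ℝ) (W₀ : Set V) : Prop :=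
  ∀ W ⊆ W₀, ∀ w, (1 - a) * ‖genFun (restrict G (W \ {w})) r z‖ ≤ ‖genFun (restrict G W) r z‖

/-- The edges of `G` with both ends in `W`. -/
noncomputable def edgesIn (G : SimpleGraph V) (W : Set V) : Finset (Sym2 V) :=
  Finset.univ.filter (· ∈ (restrict G W).edgeSet)

theorem mem_edgesIn {W : Set V} {f : Sym2 V} :
    f ∈ edgesIn G W ↔ f ∈ G.edgeSet ∧ ∀ w ∈ f, w ∈ W := by
  rw [edgesIn, Finset.mem_filter, mem_edgeSet_restrict]
  simp

/-- The broken-circuit condition is dropped: in the estimates all trees may be counted. -/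
theorem treeSets_subset {W W₀ : Set V} (hW : W ⊆ W₀) (v : V) :
    treeSets (restrict G W) r v ⊆ anchoredTrees (edgesIn G W₀) v := by
  intro T hT
  obtain ⟨hT, hanch⟩ := Finset.mem_filter.1 hT
  rw [mem_bcfSets] at hT
  refine mem_anchoredTrees.2 ⟨fun f hf => ?_, hT.acyc, hanch⟩
  have := mem_edgeSet_restrict.1 (hT.1 hf)
  exact mem_edgesIn.2 ⟨this.1, fun w hw => hW (this.2 w hw)⟩

theorem Stable.pow_mul_le {z : ℂ} {a : ℝ} {W₀ W : Set V} (h : Stable G r z a W₀) (ha : a ≤ 1)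
    (hW : W ⊆ W₀) (S : Finset V) :
    (1 - a) ^ S.card * ‖genFun (restrict G (W ∩ (S : Set V)ᶜ)) r z‖ ≤
      ‖genFun (restrict G W) r z‖ := by
  induction S using Finset.induction_on with
  | empty => simp
  | insert w S hw ih =>
    rw [Finset.card_insert_of_notMem hw, pow_succ, mul_assoc]
    refine le_trans ?_ ih
    have heq : W ∩ ((insert w S : Finset V) : Set V)ᶜ = (W ∩ (S : Set V)ᶜ) \ {w} := by
      ext y
      simp only [Finset.coe_insert, Set.mem_inter_iff, Set.mem_compl_iff, Set.mem_insert_iff,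
        Set.mem_sdiff, Set.mem_singleton_iff]
      tauto
    rw [heq]
    have h1 : 0 ≤ 1 - a := by linarith
    exact mul_le_mul_of_nonneg_left (h _ (Set.inter_subset_left.trans hW) w) (pow_nonneg h1 _)

/-- Removing the at most `|T| + 1` vertices of the tree costs as many factors `1 / (1 - a)`; the
bound on `z` absorbs all but one of them. -/
theorem Stable.tree_term_le {z : ℂ} {a x : ℝ} {W₀ W : Set V} (h : Stable G r z a W₀)
    (ha0 : 0 ≤ a) (ha : a < 1) (hz : ‖z‖ ≤ (1 - a) * x) (hW : W ⊆ W₀) {v : V}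
    {T : Finset (Sym2 V)} (hT : T ∈ treeSets (restrict G W) r v) :
    ‖z‖ ^ T.card * ‖genFun (restrict G (W ∩ (supp (T : Set (Sym2 V)) v : Set V)ᶜ)) r z‖ ≤
      x ^ T.card / (1 - a) * ‖genFun (restrict G W) r z‖ := by
  have h1 : 0 < 1 - a := by linarith
  have hx : 0 ≤ x := by
    by_contra hx
    have := norm_nonneg z
    nlinarith [mul_neg_of_pos_of_neg h1 (not_le.1 hx)]
  have hcard : (supp (T : Set (Sym2 V)) v).card ≤ T.card + 1 :=
    card_supp_le (mem_bcfSets.1 (Finset.mem_filter.1 hT).1).acyc v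
  have h2 := h.pow_mul_le ha.le hW (supp (T : Set (Sym2 V)) v)
  set X := ‖genFun (restrict G (W ∩ (supp (T : Set (Sym2 V)) v : Set V)ᶜ)) r z‖
  have hX : 0 ≤ X := norm_nonneg _
  have h3 : (1 - a) ^ (T.card + 1) * X ≤ ‖genFun (restrict G W) r z‖ :=
    (mul_le_mul_of_nonneg_right (pow_le_pow_of_le_one h1.le (by linarith) hcard) hX).trans h2
  calc ‖z‖ ^ T.card * X ≤ ((1 - a) * x) ^ T.card * X := by gcongr
    _ = x ^ T.card / (1 - a) * ((1 - a) ^ (T.card + 1) * X) := by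
        rw [mul_pow, pow_succ]
        field_simp
    _ ≤ _ := by gcongr

theorem markedSum_restrict_eq (hr : StrictTotalOn r G.edgeSet) (z : ℂ) (W : Set V) (N : Finset V)
    (v : V) :
    markedSum (restrict G W) r z N = ∑ T ∈ treeSets (restrict G W) r v, z ^ T.card *
      ((if (supp (T : Set (Sym2 V)) v ∩ N).Nonempty then 1 + z else 1) *
        markedSum (restrict G (W ∩ (supp (T : Set (Sym2 V)) v : Set V)ᶜ)) r z
          (N \ supp (T : Set (Sym2 V)) v)) := by
  simp_rw [markedSum_eq_sum_trees (hr.mono (edgeSet_restrict_subset G W)) z N v,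
    restrict_restrict]

theorem supp_inter_insert_nonempty (T : Set (Sym2 V)) (v : V) (N : Finset V) :
    (supp T v ∩ insert v N).Nonempty :=
  ⟨v, Finset.mem_inter.2 ⟨self_mem_supp T v, Finset.mem_insert_self _ _⟩⟩

theorem insert_sdiff_supp (T : Set (Sym2 V)) (v : V) (N : Finset V) :
    insert v N \ supp T v = N \ supp T v := Finset.insert_sdiff_of_mem _ (self_mem_supp T v)

/-- If the tree of `v` already meets `N`, marking `v` changes nothing; otherwise its weight rises
from `1` to `1 + z`. -/
theorem markedSum_insert_sub (hr : StrictTotalOn r G.edgeSet) (z : ℂ) (W : Set V) (N : Finset V)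
    (v : V) :
    markedSum (restrict G W) r z (insert v N) - markedSum (restrict G W) r z N =
      ∑ T ∈ treeSets (restrict G W) r v, z ^ T.card *
      ((if (supp (T : Set (Sym2 V)) v ∩ N).Nonempty then 0 else z) *
        markedSum (restrict G (W ∩ (supp (T : Set (Sym2 V)) v : Set V)ᶜ)) r z
          (N \ supp (T : Set (Sym2 V)) v)) := by
  rw [markedSum_restrict_eq hr z W (insert v N) v, markedSum_restrict_eq hr z W N v,
    ← Finset.sum_sub_distrib]
  refine Finset.sum_congr rfl fun T _ => ?_
  rw [insert_sdiff_supp, if_pos (supp_inter_insert_nonempty _ v N)]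
  split_ifs <;> ring

/-- The complementary cancellation: trees missing `N` drop out, and those meeting `N` contribute `(1
+ z) - (1 + z) ^ 2`. -/
theorem markedSum_insert_sub_mul (hr : StrictTotalOn r G.edgeSet) (z : ℂ) (W : Set V)
    (N : Finset V) (v : V) :
    markedSum (restrict G W) r z (insert v N) - (1 + z) * markedSum (restrict G W) r z N =
      ∑ T ∈ treeSets (restrict G W) r v, z ^ T.card *
      ((if (supp (T : Set (Sym2 V)) v ∩ N).Nonempty then -(z * (1 + z)) else 0) *
        markedSum (restrict G (W ∩ (supp (T : Set (Sym2 V)) v : Set V)ᶜ)) r z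
          (N \ supp (T : Set (Sym2 V)) v)) := by
  rw [markedSum_restrict_eq hr z W (insert v N) v, markedSum_restrict_eq hr z W N v,
    Finset.mul_sum, ← Finset.sum_sub_distrib]
  refine Finset.sum_congr rfl fun T _ => ?_
  rw [insert_sdiff_supp, if_pos (supp_inter_insert_nonempty _ v N)]
  split_ifs <;> ring

/-- Each further mark costs a factor `1 + b * x`: summing `Stable.tree_term_le` over the trees at
`v` gives `b`, and the extra `z` cancels the leftover `1 / (1 - a)`. The induction is strong because
a tree may swallow several marks. -/
theorem norm_markedSum_le (hr : StrictTotalOn r G.edgeSet) {z : ℂ} {a x b : ℝ} {W₀ : Set V}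
    (h : Stable G r z a W₀) (ha0 : 0 ≤ a) (ha : a < 1) (hx : 0 ≤ x) (hz : ‖z‖ ≤ (1 - a) * x)
    (hb : 0 ≤ b) (htree : ∀ v, treeSum x (edgesIn G W₀) v ≤ b) (N : Finset V) {W : Set V}
    (hW : W ⊆ W₀) :
    ‖markedSum (restrict G W) r z N‖ ≤ (1 + b * x) ^ N.card * ‖genFun (restrict G W) r z‖ := by
  induction hn : N.card using Nat.strong_induction_on generalizing N W with
  | _ n ih =>
    subst hn
    rcases N.eq_empty_or_nonempty with rfl | ⟨v, hv⟩
    · simp [markedSum_empty]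
    · obtain ⟨N', hvN', rfl⟩ : ∃ N', v ∉ N' ∧ insert v N' = N :=
        ⟨N.erase v, Finset.notMem_erase _ _, Finset.insert_erase hv⟩
      have hcard := Finset.card_insert_of_notMem hvN'
      have h1a : 0 < 1 - a := by linarith
      have hbx : 1 ≤ 1 + b * x := by nlinarith [mul_nonneg hb hx]
      set F := ‖genFun (restrict G W) r z‖ with hF
      have hF0 : 0 ≤ F := norm_nonneg _
      have hA := ih N'.card (by omega) N' hW rfl
      have hB : ‖markedSum (restrict G W) r z (insert v N') - markedSum (restrict G W) r z N'‖ ≤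
          (b * x) * (1 + b * x) ^ N'.card * F := by
        rw [markedSum_insert_sub hr]
        have hterm : ∀ T ∈ treeSets (restrict G W) r v, ‖z ^ T.card *
            ((if (supp (T : Set (Sym2 V)) v ∩ N').Nonempty then 0 else z) *
            markedSum (restrict G (W ∩ (supp (T : Set (Sym2 V)) v : Set V)ᶜ)) r z
              (N' \ supp (T : Set (Sym2 V)) v))‖ ≤
            x * (1 + b * x) ^ N'.card * F * x ^ T.card := by
          intro T hT
          have hm := ih (N' \ supp (T : Set (Sym2 V)) v).card
            (by have := Finset.card_le_card (Finset.sdiff_subset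
                  (s := N') (t := supp (T : Set (Sym2 V)) v)); omega)
            (N' \ supp (T : Set (Sym2 V)) v)
            (W := W ∩ (supp (T : Set (Sym2 V)) v : Set V)ᶜ)
            (Set.inter_subset_left.trans hW) rfl
          have hm' := hm.trans (mul_le_mul_of_nonneg_right (pow_le_pow_right₀ hbx
            (Finset.card_le_card (Finset.sdiff_subset
              (s := N') (t := supp (T : Set (Sym2 V)) v)))) (norm_nonneg _))
          have ht := h.tree_term_le ha0 ha hz hW hT
          have hzn : ‖(if (supp (T : Set (Sym2 V)) v ∩ N').Nonempty then 0 else z)‖ ≤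
              (1 - a) * x := by
            split_ifs
            · simpa using mul_nonneg h1a.le hx
            · exact hz
          rw [norm_mul, norm_mul, norm_pow]
          set X := ‖genFun (restrict G (W ∩ (supp (T : Set (Sym2 V)) v : Set V)ᶜ)) r z‖
          calc _ ≤ ‖z‖ ^ T.card * (((1 - a) * x) * ((1 + b * x) ^ N'.card * X)) := by gcongr
            _ = (((1 - a) * x) * (1 + b * x) ^ N'.card) * (‖z‖ ^ T.card * X) := by ring
            _ ≤ (((1 - a) * x) * (1 + b * x) ^ N'.card) * (x ^ T.card / (1 - a) * F) := by gcongr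
            _ = _ := by field_simp
        refine (norm_sum_le _ _).trans ((Finset.sum_le_sum hterm).trans ?_)
        rw [← Finset.mul_sum]
        have hs : ∑ T ∈ treeSets (restrict G W) r v, x ^ T.card ≤ b :=
          (Finset.sum_le_sum_of_subset_of_nonneg (treeSets_subset hW v)
            fun _ _ _ => by positivity).trans (htree v)
        calc _ ≤ x * (1 + b * x) ^ N'.card * F * b := by gcongr
          _ = _ := by ring
      have := norm_le_norm_add_norm_sub' (markedSum (restrict G W) r z (insert v N'))
        (markedSum (restrict G W) r z N')
      rw [hcard, pow_succ]
      linarith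

/-- Only trees joining `v` to `N` survive, and a union bound over the vertex of `N` they reach
produces `|N| * M`. -/
theorem norm_markedSum_insert_sub_mul_le (hr : StrictTotalOn r G.edgeSet) {z : ℂ} {a x b M : ℝ}
    {W₀ : Set V} (h : Stable G r z a W₀) (ha0 : 0 ≤ a) (ha : a < 1) (hx : 0 ≤ x)
    (hz : ‖z‖ ≤ (1 - a) * x) (hb : 1 ≤ b) (htree : ∀ v, treeSum x (edgesIn G W₀) v ≤ b)
    (N : Finset V) (v : V) (hpair : ∀ s ∈ N, pairSum x (edgesIn G W₀) v s ≤ M) {W : Set V}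
    (hW : W ⊆ W₀) :
    ‖markedSum (restrict G W) r z (insert v N) - (1 + z) * markedSum (restrict G W) r z N‖ ≤
      N.card * M * x * (1 + b * x) ^ N.card * ‖genFun (restrict G W) r z‖ := by
  have h1a : 0 < 1 - a := by linarith
  have hbx0 : 0 ≤ b * x := mul_nonneg (by linarith) hx
  have hbx : 1 ≤ 1 + b * x := by linarith
  have hz1 : ‖1 + z‖ ≤ 1 + b * x := by
    refine (norm_add_le _ _).trans ?_
    rw [norm_one]
    nlinarith
  set F := ‖genFun (restrict G W) r z‖ with hF
  have hF0 : 0 ≤ F := norm_nonneg _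
  rw [markedSum_insert_sub_mul hr]
  have hterm : ∀ T ∈ treeSets (restrict G W) r v, ‖z ^ T.card *
      ((if (supp (T : Set (Sym2 V)) v ∩ N).Nonempty then -(z * (1 + z)) else 0) *
        markedSum (restrict G (W ∩ (supp (T : Set (Sym2 V)) v : Set V)ᶜ)) r z
          (N \ supp (T : Set (Sym2 V)) v))‖ ≤
      x * (1 + b * x) ^ N.card * F *
        ∑ s ∈ N, if Conn (T : Set (Sym2 V)) v s then x ^ T.card else 0 := by
    intro T hT
    have hnn : ∀ s ∈ N, 0 ≤ if Conn (T : Set (Sym2 V)) v s then x ^ T.card else 0 := by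
      intro s _
      split_ifs <;> positivity
    split_ifs with hne
    · obtain ⟨s, hs⟩ := hne
      obtain ⟨hsv, hsN⟩ := Finset.mem_inter.1 hs
      have hsum := Finset.single_le_sum hnn hsN
      rw [if_pos (mem_supp.1 hsv)] at hsum
      -- The tree removes at least one mark, which pays for the factor `1 + z`.
      have hcard : (N \ supp (T : Set (Sym2 V)) v).card + 1 ≤ N.card := by
        refine Finset.card_lt_card (Finset.ssubset_iff_of_subset Finset.sdiff_subset |>.2 ?_)
        exact ⟨s, hsN, by simp [hsv]⟩
      have hm := norm_markedSum_le hr h ha0 ha hx hz (by linarith) htree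
        (N \ supp (T : Set (Sym2 V)) v) (W := W ∩ (supp (T : Set (Sym2 V)) v : Set V)ᶜ)
        (Set.inter_subset_left.trans hW)
      have ht := h.tree_term_le ha0 ha hz hW hT
      rw [norm_mul, norm_mul, norm_pow, norm_neg, norm_mul]
      set X := ‖genFun (restrict G (W ∩ (supp (T : Set (Sym2 V)) v : Set V)ᶜ)) r z‖
      set m := (N \ supp (T : Set (Sym2 V)) v).card
      calc _ ≤ ‖z‖ ^ T.card * (((1 - a) * x) * (1 + b * x) * ((1 + b * x) ^ m * X)) := by gcongr
        _ = ((1 - a) * x) * (1 + b * x) ^ (m + 1) * (‖z‖ ^ T.card * X) := by ring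
        _ ≤ ((1 - a) * x) * (1 + b * x) ^ N.card * (x ^ T.card / (1 - a) * F) := by gcongr
        _ = x * (1 + b * x) ^ N.card * F * x ^ T.card := by field_simp
        _ ≤ _ := by gcongr
    · simp only [zero_mul, mul_zero, norm_zero]
      have := Finset.sum_nonneg hnn
      positivity
  refine (norm_sum_le _ _).trans ((Finset.sum_le_sum hterm).trans ?_)
  rw [← Finset.mul_sum, Finset.sum_comm]
  have hs : ∑ s ∈ N, ∑ T ∈ treeSets (restrict G W) r v,
      (if Conn (T : Set (Sym2 V)) v s then x ^ T.card else 0) ≤ ∑ _s ∈ N, M := by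
    refine Finset.sum_le_sum fun s hs => ?_
    refine le_trans ?_ (hpair s hs)
    rw [pairSum, ← Finset.sum_filter]
    exact Finset.sum_le_sum_of_subset_of_nonneg
      (Finset.filter_subset_filter _ (treeSets_subset hW v)) fun _ _ _ => by positivity
  rw [Finset.sum_const, nsmul_eq_mul] at hs
  calc _ ≤ x * (1 + b * x) ^ N.card * F * (N.card * M) := by gcongr
    _ = _ := by ring

theorem norm_one_add_pow_sub_one_le (z : ℂ) (n : ℕ) :
    ‖(1 + z) ^ n - 1‖ ≤ (1 + ‖z‖) ^ n - 1 := by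
  induction n with
  | zero => simp
  | succ n ih =>
    have h1 : (1 + z) ^ (n + 1) - 1 = (1 + z) * ((1 + z) ^ n - 1) + z := by ring
    have h2 : ‖1 + z‖ ≤ 1 + ‖z‖ := (norm_add_le _ _).trans (by rw [norm_one])
    rw [h1]
    calc _ ≤ ‖1 + z‖ * ‖(1 + z) ^ n - 1‖ + ‖z‖ := by rw [← norm_mul]; exact norm_add_le _ _
      _ ≤ (1 + ‖z‖) * ((1 + ‖z‖) ^ n - 1) + ‖z‖ := by gcongr
      _ = _ := by ring

/-- Marks are added one by one; the `n + 1`-st contributes `n` pairs, and these add up to the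
binomial coefficient. -/
theorem norm_markedSum_sub_le (hr : StrictTotalOn r G.edgeSet) {z : ℂ} {a x b M : ℝ}
    {W₀ : Set V} (h : Stable G r z a W₀) (ha0 : 0 ≤ a) (ha : a < 1) (hx : 0 ≤ x)
    (hz : ‖z‖ ≤ (1 - a) * x) (hb : 1 ≤ b) (hM : 0 ≤ M)
    (htree : ∀ v, treeSum x (edgesIn G W₀) v ≤ b) (N : Finset V)
    (hpair : ∀ v ∈ N, ∀ s ∈ N, v ≠ s → pairSum x (edgesIn G W₀) v s ≤ M) {W : Set V}
    (hW : W ⊆ W₀) :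
    ‖markedSum (restrict G W) r z N - (1 + z) ^ N.card * genFun (restrict G W) r z‖ ≤
      N.card.choose 2 * M * x * (1 + b * x) ^ (N.card - 1) * ‖genFun (restrict G W) r z‖ := by
  induction N using Finset.induction_on with
  | empty => simp [markedSum_empty]
  | insert v N hv ih =>
    have hbx0 : 0 ≤ b * x := mul_nonneg (by linarith) hx
    have hz1 : ‖1 + z‖ ≤ 1 + b * x := by
      refine (norm_add_le _ _).trans ?_
      rw [norm_one]
      nlinarith
    have h1 := norm_markedSum_insert_sub_mul_le hr h ha0 ha hx hz hb htree N v
      (fun s hs => hpair v (Finset.mem_insert_self _ _) s (Finset.mem_insert_of_mem hs)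
        (by rintro rfl; exact hv hs)) hW
    have h2 := ih fun v hv s hs => hpair v (Finset.mem_insert_of_mem hv) s
      (Finset.mem_insert_of_mem hs)
    rw [Finset.card_insert_of_notMem hv, Nat.add_sub_cancel]
    set F := genFun (restrict G W) r z
    set H := markedSum (restrict G W) r z (insert v N)
    set H' := markedSum (restrict G W) r z N
    set n := N.card
    have h3 : ‖(1 + z) * (H' - (1 + z) ^ n * F)‖ ≤
        n.choose 2 * M * x * (1 + b * x) ^ n * ‖F‖ := by
      rw [norm_mul]
      have h4 : ‖1 + z‖ * ‖H' - (1 + z) ^ n * F‖ ≤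
          (1 + b * x) * (n.choose 2 * M * x * (1 + b * x) ^ (n - 1) * ‖F‖) := by gcongr
      refine h4.trans (le_of_eq ?_)
      rcases n with _ | n
      · simp
      · rw [Nat.add_sub_cancel, pow_succ]
        ring
    have h5 : H - (1 + z) ^ (n + 1) * F =
        (H - (1 + z) * H') + (1 + z) * (H' - (1 + z) ^ n * F) := by ring
    rw [h5]
    refine (norm_add_le _ _).trans ((add_le_add h1 h3).trans (le_of_eq ?_))
    have h6 : ((n + 1).choose 2 : ℝ) = n + n.choose 2 := by
      rw [Nat.choose_succ_succ' n 1]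
      push_cast
      simp
    rw [h6]
    ring

/-- One step of the induction over vertex sets: the ratio bound at `u` follows from the stability
of the generating function below `W`. -/
theorem norm_genFun_sub_le (hr : StrictTotalOn r G.edgeSet) {z : ℂ} {a x b M : ℝ} {Δ : ℕ}
    {U : Set V} {u : V} (h : Stable G r z a (U \ {u})) (ha0 : 0 ≤ a) (ha : a < 1) (hx : 0 ≤ x)
    (hz : ‖z‖ ≤ (1 - a) * x) (hb : 1 ≤ b) (hM : 0 ≤ M)
    (htree : ∀ v, treeSum x (edgesIn G (U \ {u})) v ≤ b)
    (hpair : ∀ v s, G.Adj u v → G.Adj u s → v ≠ s → pairSum x (edgesIn G (U \ {u})) v s ≤ M)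
    (hdeg : (Finset.univ.filter (G.Adj u)).card ≤ Δ)
    (hK : (1 + (1 - a) * x) ^ Δ - 1 + Δ.choose 2 * M * x * (1 + b * x) ^ (Δ - 1) ≤ a) :
    ‖genFun (restrict G U) r z - genFun (restrict G (U \ {u})) r z‖ ≤
      a * ‖genFun (restrict G (U \ {u})) r z‖ := by
  set N := Finset.univ.filter ((restrict G U).Adj u) with hN
  have hmarked : genFun (restrict G U) r z = markedSum (restrict G (U \ {u})) r z N := by
    rw [genFun_eq_sum_restrict (hr.mono (edgeSet_restrict_subset G U)) u z, restrict_restrict,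
      Set.sdiff_eq]
    rfl
  have hNadj : ∀ v ∈ N, G.Adj u v := fun v hv => (Finset.mem_filter.1 hv).2.2.2
  have hNcard : N.card ≤ Δ := (Finset.card_le_card fun v hv => by
    simpa using hNadj v hv).trans hdeg
  rw [hmarked]
  have h1 := norm_markedSum_sub_le hr h ha0 ha hx hz hb hM htree N
    (fun v hv s hs => hpair v s (hNadj v hv) (hNadj s hs)) le_rfl
  set F := genFun (restrict G (U \ {u})) r z
  set H := markedSum (restrict G (U \ {u})) r z N
  have hbx0 : 0 ≤ b * x := mul_nonneg (by linarith) hx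
  have hbx1 : 1 ≤ 1 + b * x := by linarith
  have h2 : ‖(1 + z) ^ N.card * F - F‖ ≤ ((1 + (1 - a) * x) ^ Δ - 1) * ‖F‖ := by
    rw [show (1 + z) ^ N.card * F - F = ((1 + z) ^ N.card - 1) * F by ring, norm_mul]
    refine mul_le_mul_of_nonneg_right ?_ (norm_nonneg _)
    refine (norm_one_add_pow_sub_one_le z _).trans ?_
    have h3 : (1 + ‖z‖) ^ N.card ≤ (1 + ‖z‖) ^ Δ :=
      pow_le_pow_right₀ (by linarith [norm_nonneg z]) hNcard
    have h4 : (1 + ‖z‖) ^ Δ ≤ (1 + (1 - a) * x) ^ Δ := by gcongr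
    linarith
  have h3 : (N.card.choose 2 : ℝ) * M * x * (1 + b * x) ^ (N.card - 1) * ‖F‖ ≤
      Δ.choose 2 * M * x * (1 + b * x) ^ (Δ - 1) * ‖F‖ := by
    have hc : (N.card.choose 2 : ℝ) ≤ Δ.choose 2 := by
      exact_mod_cast Nat.choose_le_choose 2 hNcard
    have hp : (1 + b * x) ^ (N.card - 1) ≤ (1 + b * x) ^ (Δ - 1) :=
      pow_le_pow_right₀ hbx1 (by omega)
    gcongr
  have h4 : H - F = (H - (1 + z) ^ N.card * F) + ((1 + z) ^ N.card * F - F) := by ring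
  rw [h4]
  refine (norm_add_le _ _).trans ?_
  nlinarith [norm_nonneg F]

/-- The ratio bound for all vertex sets. -/
theorem norm_genFun_sub_le_of_kernel (hr : StrictTotalOn r G.edgeSet) {z : ℂ} {a x b M : ℝ}
    {Δ : ℕ} (ha0 : 0 ≤ a) (ha : a < 1) (hx : 0 ≤ x)
    (hz : ‖z‖ ≤ (1 - a) * x) (hb : 1 ≤ b) (hM : 0 ≤ M)
    (htree : ∀ W v, treeSum x (edgesIn G W) v ≤ b)
    (hpair : ∀ W u v s, u ∉ W → G.Adj u v → G.Adj u s → v ≠ s →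
      pairSum x (edgesIn G W) v s ≤ M)
    (hdeg : ∀ u, (Finset.univ.filter (G.Adj u)).card ≤ Δ)
    (hK : (1 + (1 - a) * x) ^ Δ - 1 + Δ.choose 2 * M * x * (1 + b * x) ^ (Δ - 1) ≤ a)
    (U : Set V) (u : V) :
    ‖genFun (restrict G U) r z - genFun (restrict G (U \ {u})) r z‖ ≤
      a * ‖genFun (restrict G (U \ {u})) r z‖ := by
  have key : ∀ n : ℕ, ∀ U : Set V, U.ncard = n → ∀ u,
      ‖genFun (restrict G U) r z - genFun (restrict G (U \ {u})) r z‖ ≤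
        a * ‖genFun (restrict G (U \ {u})) r z‖ := by
    intro n
    induction n using Nat.strong_induction_on with
    | _ n ih =>
      rintro U rfl u
      by_cases hu : u ∈ U
      · refine norm_genFun_sub_le hr ?_ ha0 ha hx hz hb hM (htree _)
          (fun v s => hpair _ u v s (by simp)) (hdeg u) hK
        -- Stability below `U \ {u}` is the induction hypothesis combined with the triangle
        -- inequality.
        intro W hW w
        have hlt : W.ncard < U.ncard :=
          Set.ncard_lt_ncard (Set.ssubset_iff_subset_ne.2 ⟨hW.trans Set.sdiff_subset, by
            rintro rfl; exact (hW hu).2 rfl⟩) (Set.toFinite _)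
        have h1 := ih _ hlt W rfl w
        have h2 := norm_le_norm_add_norm_sub (genFun (restrict G W) r z)
          (genFun (restrict G (W \ {w})) r z)
        linarith
      · rw [Set.sdiff_singleton_eq_self hu, sub_self, norm_zero]
        positivity
  exact key _ U rfl u

end Estimates

/-! ### The functions `x_Δ` and `f_Δ`, and the choice of `b` -/

section Radius

/-- The root `b ^ (1 / Δ)`, the weight of one edge at the root of the `Δ`-regular tree. -/
noncomputable def edgeRoot (Δ : ℕ) (b : ℝ) : ℝ := b ^ ((1 : ℝ) / Δ)

theorem edgeRoot_pow {Δ : ℕ} (hΔ : 1 ≤ Δ) {b : ℝ} (hb : 0 ≤ b) : edgeRoot Δ b ^ Δ = b := by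
  rw [edgeRoot, one_div, Real.rpow_inv_natCast_pow hb (by omega)]

theorem one_le_edgeRoot {Δ : ℕ} {b : ℝ} (hb : 1 ≤ b) : 1 ≤ edgeRoot Δ b :=
  Real.one_le_rpow hb (by positivity)

/-- The substitution `b = L ^ Δ` removes the real powers. With `Y = L ^ (Δ - 1)` it makes `1 + x * Y
= L`, so `(1 + x * Y) ^ (Δ - 1) = Y` holds exactly. -/
theorem xFun_pow {Δ : ℕ} (hΔ : 1 ≤ Δ) {L : ℝ} (hL : 0 < L) :
    xFun Δ (L ^ Δ) = (L - 1) / L ^ (Δ - 1) := by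
  have h0 : (Δ : ℝ) ≠ 0 := by positivity
  have h1 : (L ^ Δ) ^ ((1 : ℝ) / Δ) = L := by
    rw [one_div, Real.pow_rpow_inv_natCast hL.le (by omega)]
  have h2 : (L ^ Δ) ^ ((2 : ℝ) / Δ) = L ^ 2 := by
    rw [← Real.rpow_natCast, ← Real.rpow_mul hL.le, ← Real.rpow_natCast]
    congr 1
    push_cast
    field_simp
  obtain ⟨k, rfl⟩ : ∃ k, Δ = k + 1 := ⟨Δ - 1, by omega⟩
  rw [xFun, h1, h2, Nat.add_sub_cancel, pow_succ L k]
  field_simp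

theorem fFun_pow {Δ : ℕ} (hΔ : 1 ≤ Δ) {L : ℝ} (hL : 0 < L) (d : ℕ) :
    fFun Δ d (L ^ Δ) = 1 / ((Δ : ℝ) - 1) *
      ((((Δ : ℝ) - 1) * ((L - 1) / L)) ^ d / (1 - ((Δ : ℝ) - 1) * ((L - 1) / L))) := by
  have h0 : (Δ : ℝ) ≠ 0 := by positivity
  have h1 : (L ^ Δ) ^ (-(1 : ℝ) / Δ) = 1 / L := by
    rw [neg_div, Real.rpow_neg (by positivity), one_div,
      Real.pow_rpow_inv_natCast hL.le (by omega), one_div]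
  have h2 : 1 - 1 / L = (L - 1) / L := by field_simp
  rw [fFun, if_neg (ENat.natCast_ne_top d), h1, h2]
  rfl

/-- The bound `ρ_Δ` is what makes the geometric series in `pairSum_le` converge. -/
theorem mul_lt_one_of_lt_rho {Δ : ℕ} (hΔ : 2 ≤ Δ) {L : ℝ} (hL : 1 ≤ L)
    (h : ((L ^ Δ : ℝ) : EReal) < rho Δ) : ((Δ : ℝ) - 1) * ((L - 1) / L) < 1 := by
  have hL0 : 0 < L := by linarith
  rw [mul_div_assoc', div_lt_one hL0]
  by_cases h2 : Δ = 2
  · subst h2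
    push_cast
    linarith
  · have h3 : (3 : ℝ) ≤ Δ := by
      have : 3 ≤ Δ := by omega
      exact_mod_cast this
    rw [rho, if_neg (by omega), EReal.coe_lt_coe_iff] at h
    have h4 : L < ((Δ : ℝ) - 1) / ((Δ : ℝ) - 2) :=
      lt_of_pow_lt_pow_left₀ Δ (div_nonneg (by linarith) (by linarith)) h
    rw [lt_div_iff₀ (by linarith)] at h4
    linarith

theorem fFun_nonneg {Δ : ℕ} (hΔ : 1 ≤ Δ) {L : ℝ} (hL : 1 ≤ L)
    (h : ((L ^ Δ : ℝ) : EReal) < rho Δ) (d : ℕ∞) : 0 ≤ fFun Δ d (L ^ Δ) := by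
  have hL0 : 0 < L := by linarith
  induction d with
  | top => simp [fFun]
  | coe d =>
    rw [fFun_pow hΔ hL0]
    -- Here the prefactor is `1 / 0 = 0`.
    by_cases h1 : Δ = 1
    · subst h1
      simp
    · have hΔ2 : 2 ≤ Δ := by omega
      have h2 := mul_lt_one_of_lt_rho hΔ2 hL h
      have h3 : (2 : ℝ) ≤ Δ := by exact_mod_cast hΔ2
      have h4 : 0 ≤ (Δ : ℝ) - 1 := by linarith
      have h5 : 0 ≤ 1 - ((Δ : ℝ) - 1) * ((L - 1) / L) := by linarith
      have h6 : 0 ≤ L - 1 := by linarith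
      positivity

theorem continuousAt_xFun (Δ : ℕ) {t : ℝ} (ht : t ≠ 0) : ContinuousAt (xFun Δ) t := by
  unfold xFun
  exact ((Real.continuousAt_rpow_const _ _ (Or.inl ht)).sub
    (Real.continuousAt_rpow_const _ _ (Or.inl ht))).div continuousAt_id ht

theorem xFun_zero (Δ : ℕ) : xFun Δ 0 = 0 := by simp [xFun]

/-- Values of `x_Δ` close to a supremum are approached from within the set. -/
theorem exists_lt_xFun_of_lt_sSup {Δ : ℕ} {S : Set EReal} {t c : ℝ} (ht : t ≠ 0)
    (hc : c < xFun Δ t) (hS : ∀ b ∈ S, b ≤ (t : EReal)) (hsup : (t : EReal) ≤ sSup S) :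
    ∃ b ∈ S, ∀ s : ℝ, b = s → c < xFun Δ s := by
  obtain ⟨δ, hδ, hball⟩ := Metric.eventually_nhds_iff.1
    ((continuousAt_xFun Δ ht).eventually (lt_mem_nhds hc))
  have hlt : ((t - δ : ℝ) : EReal) < sSup S :=
    lt_of_lt_of_le (EReal.coe_lt_coe_iff.2 (by linarith)) hsup
  obtain ⟨b, hb, hlt⟩ := lt_sSup_iff.1 hlt
  refine ⟨b, hb, ?_⟩
  rintro s rfl
  have h1 := EReal.coe_lt_coe_iff.1 hlt
  have h2 := EReal.coe_le_coe_iff.1 (hS _ hb)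
  exact hball (by rw [Real.dist_eq, abs_lt]; constructor <;> linarith)

/-- For `Δ ≥ 3` the limit at `ρ_Δ` is an ordinary value of the formula, so continuity also covers a
supremum equal to `ρ_Δ`. -/
theorem xFun_rho {Δ : ℕ} (hΔ : 3 ≤ Δ) :
    xFun Δ ((((Δ : ℝ) - 1) / ((Δ : ℝ) - 2)) ^ Δ) =
      ((Δ : ℝ) - 2) ^ (Δ - 2) / ((Δ : ℝ) - 1) ^ (Δ - 1) := by
  have h3 : (3 : ℝ) ≤ Δ := by exact_mod_cast hΔ
  have h1 : 0 < (Δ : ℝ) - 1 := by linarith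
  have h2 : 0 < (Δ : ℝ) - 2 := by linarith
  rw [xFun_pow (by omega) (div_pos h1 h2)]
  have h4 : ((Δ : ℝ) - 1) / ((Δ : ℝ) - 2) - 1 = 1 / ((Δ : ℝ) - 2) := by
    field_simp
    ring
  obtain ⟨k, rfl⟩ : ∃ k, Δ = k + 2 := ⟨Δ - 2, by omega⟩
  rw [h4, show k + 2 - 1 = k + 1 by omega, Nat.add_sub_cancel, div_pow]
  rw [pow_succ (((k + 2 : ℕ) : ℝ) - 2) k]
  field_simp

/-- Below the radius, the kernel condition holds for some `b` with a sufficient `x_Δ(b)`. -/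
theorem exists_kernel_of_lt_zRadius {Δ : ℕ} (hΔ : 1 ≤ Δ) {g : ℕ∞} {a ζ : ℝ}
    (ha : a < 1) (hζ : 0 ≤ ζ) (h : (ζ : EReal) < zRadius Δ g a) :
    ∃ b : ℝ, 1 ≤ b ∧ (b : EReal) < rho Δ ∧ kFun Δ g a b ≤ a ∧ ζ ≤ (1 - a) * xFun Δ b := by
  have h1a : 0 < 1 - a := by linarith
  rw [zRadius, if_neg (fun h => ha.ne h.2)] at h
  set c := ζ / (1 - a) with hc
  have hc0 : 0 ≤ c := by positivity
  have hcX : (c : EReal) < xExt Δ (bSup Δ g a) := by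
    generalize xExt Δ (bSup Δ g a) = X at h
    induction X with
    | bot =>
      rw [EReal.coe_mul_bot_of_pos h1a] at h
      exact absurd h not_lt_bot
    | top => exact EReal.coe_lt_top c
    | coe X =>
      rw [← EReal.coe_mul, EReal.coe_lt_coe_iff] at h
      rw [EReal.coe_lt_coe_iff, hc, div_lt_iff₀ h1a]
      linarith
  set S := {b : EReal | ∃ t : ℝ, b = (t : EReal) ∧ 1 ≤ t ∧ (t : EReal) < rho Δ ∧
    kFun Δ g a t ≤ a} with hS
  have hβ : bSup Δ g a = sSup S := rfl
  suffices hmain : ∃ b ∈ S, ∀ s : ℝ, b = s → c ≤ xFun Δ s by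
    obtain ⟨b, ⟨t, rfl, ht1, htρ, hK⟩, hle⟩ := hmain
    refine ⟨t, ht1, htρ, hK, ?_⟩
    have := hle t rfl
    rw [hc, div_le_iff₀ h1a] at this
    linarith
  rw [hβ, xExt] at hcX
  split_ifs at hcX with hρ
  · rw [EReal.coe_lt_coe_iff] at hcX
    -- This rules out an empty `S`, whose supremum `⊥` has `toReal` equal to `0`.
    have ht : (sSup S).toReal ≠ 0 := by
      intro h0
      rw [h0, xFun_zero] at hcX
      linarith
    have hcoe : ((sSup S).toReal : EReal) = sSup S := by
      apply EReal.coe_toReal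
      · exact (lt_of_lt_of_le hρ le_top).ne
      · intro hbot
        rw [hbot] at ht
        simp at ht
    obtain ⟨b, hb, hlt⟩ := exists_lt_xFun_of_lt_sSup ht hcX
      (fun b hb => by rw [hcoe]; exact le_sSup hb) hcoe.le
    exact ⟨b, hb, fun s hs => (hlt s hs).le⟩
  · rw [not_lt] at hρ
    by_cases h3 : 3 ≤ Δ
    · have hΔ3 : (3 : ℝ) ≤ Δ := by exact_mod_cast h3
      rw [bigR, if_neg (by omega), if_neg (by omega), EReal.coe_lt_coe_iff, ← xFun_rho h3] at hcX
      have hrho : rho Δ = (((((Δ : ℝ) - 1) / ((Δ : ℝ) - 2)) ^ Δ : ℝ) : EReal) :=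
        if_neg (by omega)
      have hpos : 0 < (((Δ : ℝ) - 1) / ((Δ : ℝ) - 2)) ^ Δ :=
        pow_pos (div_pos (by linarith) (by linarith)) _
      obtain ⟨b, hb, hlt⟩ := exists_lt_xFun_of_lt_sSup (S := S) hpos.ne' hcX
        (fun b hb => by
          obtain ⟨t, rfl, _, htρ, _⟩ := hb
          rw [← hrho]
          exact htρ.le) (hrho ▸ hρ)
      exact ⟨b, hb, fun s hs => (hlt s hs).le⟩
    · have hrho : rho Δ = ⊤ := if_pos (by omega)
      rw [hrho] at hρ
      by_cases h1 : Δ = 1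
      · subst h1
        -- For `Δ = 1`, `x_Δ(b) = b - 1`.
        obtain ⟨b, hb, hlt⟩ := lt_sSup_iff.1 (lt_of_lt_of_le (EReal.coe_lt_top (c + 1)) hρ)
        refine ⟨b, hb, ?_⟩
        rintro s rfl
        have h2 := EReal.coe_lt_coe_iff.1 hlt
        have h4 := xFun_pow (Δ := 1) le_rfl (L := s) (by linarith)
        simp only [pow_one, Nat.sub_self, pow_zero, div_one] at h4
        rw [h4]
        linarith
      · have h2 : Δ = 2 := by omega
        subst h2
        have hc1 : c < 1 := by
          rw [bigR, if_neg (by omega), if_pos rfl] at hcX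
          exact_mod_cast hcX
        -- For `Δ = 2`, `x_Δ(b) = 1 - b ^ (-1 / 2)`, which exceeds `c` beyond this threshold.
        obtain ⟨b, hb, hlt⟩ := lt_sSup_iff.1
          (lt_of_lt_of_le (EReal.coe_lt_top ((1 / (1 - c)) ^ 2)) hρ)
        refine ⟨b, hb, ?_⟩
        rintro s rfl
        have h3 := EReal.coe_lt_coe_iff.1 hlt
        have hc2 : 0 < 1 - c := by linarith
        have hs0 : 0 < s := lt_of_le_of_lt (by positivity) h3
        have hroot := edgeRoot_pow (Δ := 2) (by omega) hs0.le
        have hL0 : 0 < edgeRoot 2 s := Real.rpow_pos_of_pos hs0 _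
        have h4 : 1 / (1 - c) < edgeRoot 2 s :=
          lt_of_pow_lt_pow_left₀ 2 hL0.le (by rw [hroot]; exact h3)
        rw [← hroot, xFun_pow (by omega) hL0, pow_one, le_div_iff₀ hL0]
        rw [div_lt_iff₀ hc2] at h4
        linarith

end Radius

/-! ### Degree and girth bounds for the tree sums in `G` -/

section Graph

variable {V : Type*} [Fintype V] {G : SimpleGraph V}

theorem edgeDeg_edgesIn_le (W : Set V) (v : V) :
    edgeDeg (edgesIn G W) v ≤ (Finset.univ.filter (G.Adj v)).card := by
  rw [← card_edgeNbrs]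
  refine Finset.card_le_card fun s hs => ?_
  simpa using (mem_edgesIn.1 (mem_edgeNbrs.1 hs)).1

theorem edgeDeg_edgesIn_lt {W : Set V} {u v : V} (hu : u ∉ W) (huv : G.Adj u v) :
    edgeDeg (edgesIn G W) v < (Finset.univ.filter (G.Adj v)).card := by
  rw [← card_edgeNbrs]
  refine Finset.card_lt_card (Finset.ssubset_iff_of_subset ?_ |>.2 ⟨u, ?_, ?_⟩)
  · intro s hs
    simpa using (mem_edgesIn.1 (mem_edgeNbrs.1 hs)).1
  · simpa using huv.symm
  · intro h
    exact hu ((mem_edgesIn.1 (mem_edgeNbrs.1 h)).2 u (by simp))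

/-- A walk that avoids `u` between two neighbours of `u` yields a cycle. -/
theorem egirth_le_length_add_two {W : Set V} {u v s : V} (hu : u ∉ W) (huv : G.Adj u v)
    (hus : G.Adj u s) (hvs : v ≠ s)
    (p : (SimpleGraph.fromEdgeSet (edgesIn G W : Set (Sym2 V))).Walk v s) :
    G.egirth ≤ (p.length + 2 : ℕ) := by
  have hle : SimpleGraph.fromEdgeSet (edgesIn G W : Set (Sym2 V)) ≤ G := by
    intro a b hab
    exact (mem_edgesIn.1 hab.1).1
  have hq : p.bypass.IsPath := p.bypass_isPath
  -- A walk along edges inside `W` could meet `u ∉ W` only at its start, which is a neighbour of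
  -- `u`.
  have husupp : u ∉ p.bypass.support := by
    intro h
    have hr : Conn (edgesIn G W : Set (Sym2 V)) v u :=
      conn_iff_reachable.2 ⟨p.bypass.takeUntil u h⟩
    rcases Relation.ReflTransGen.cases_tail hr with h | ⟨c, -, hc⟩
    · exact huv.ne h
    · exact hu ((mem_edgesIn.1 hc).2 u (by simp))
  set q := p.bypass.mapLe hle with hqdef
  have hqpath : q.IsPath := hq.mapLe hle
  have hqsupp : u ∉ q.support := by simpa [hqdef] using husupp
  have hpath : (q.concat hus.symm).IsPath := hqpath.concat hqsupp hus.symm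
  have hcyc : (SimpleGraph.Walk.cons huv (q.concat hus.symm)).IsCycle := by
    rw [SimpleGraph.Walk.cons_isCycle_iff]
    refine ⟨hpath, fun h => ?_⟩
    rw [SimpleGraph.Walk.edges_concat, List.concat_eq_append, List.mem_append] at h
    rcases h with h | h
    · exact hqsupp (q.fst_mem_support_of_mem_edges h)
    · rw [List.mem_singleton, Sym2.eq_swap] at h
      exact hvs (Sym2.congr_left.1 h)
  refine (SimpleGraph.egirth_le_length hcyc).trans ?_
  have hlen : q.length ≤ p.length := by
    simpa [hqdef] using p.length_bypass_le_length
  rw [SimpleGraph.Walk.length_cons, SimpleGraph.Walk.length_concat]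
  exact_mod_cast by omega

variable {Δ : ℕ}

theorem treeSum_edgesIn_le (hΔ : 1 ≤ Δ) (hdeg : ∀ u, (Finset.univ.filter (G.Adj u)).card ≤ Δ)
    {L : ℝ} (hL : 1 ≤ L) (W : Set V) (v : V) :
    treeSum (xFun Δ (L ^ Δ)) (edgesIn G W) v ≤ L ^ Δ := by
  have hL0 : 0 < L := by linarith
  rw [xFun_pow hΔ hL0]
  have hxY : 1 + (L - 1) / L ^ (Δ - 1) * L ^ (Δ - 1) = L := by
    field_simp
    ring
  have h := treeSum_le_pow (x := (L - 1) / L ^ (Δ - 1)) (Y := L ^ (Δ - 1)) (k := Δ - 1)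
    (div_nonneg (by linarith) (by positivity)) (by positivity) (by rw [hxY]) (edgesIn G W)
    (fun w => (edgeDeg_edgesIn_le W w).trans ((hdeg w).trans (by omega))) v
  rw [hxY] at h
  exact h.trans (pow_le_pow_right₀ hL ((edgeDeg_edgesIn_le W v).trans (hdeg v)))

/-- Both hypotheses of `pairSum_le` come from the absence of `u`: `v` has lost an edge, and a walk
from `v` to `s` closes to a cycle through `u`, hence has length at least `g - 2`. -/
theorem pairSum_edgesIn_le (hΔ : 1 ≤ Δ) (hdeg : ∀ u, (Finset.univ.filter (G.Adj u)).card ≤ Δ)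
    {g : ℕ∞} (hg : 3 ≤ g) (hGg : g ≤ G.egirth) {L : ℝ} (hL : 1 ≤ L)
    (hρ : ((L ^ Δ : ℝ) : EReal) < rho Δ) (W : Set V) (u v s : V)
    (hu : u ∉ W) (huv : G.Adj u v) (hus : G.Adj u s) (hvs : v ≠ s) :
    pairSum (xFun Δ (L ^ Δ)) (edgesIn G W) v s ≤ L ^ Δ * fFun Δ (g - 2) (L ^ Δ) := by
  have hL0 : 0 < L := by linarith
  have hΔ2 : 2 ≤ Δ := by
    refine le_trans ?_ (hdeg u)
    rw [← Finset.card_pair hvs]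
    refine Finset.card_le_card fun w hw => ?_
    rcases Finset.mem_insert.1 hw with rfl | hw
    · simpa using huv
    · rw [Finset.mem_singleton.1 hw]
      simpa using hus
  have hwalk := fun p => hGg.trans (egirth_le_length_add_two hu huv hus hvs p)
  induction g with
  | top =>
    -- With infinite girth no tree off `u` can contain two neighbours of `u`.
    have hempty : (anchoredTrees (edgesIn G W) v).filter
        (fun T : Finset (Sym2 V) => Conn (T : Set (Sym2 V)) v s) = ∅ := by
      refine Finset.filter_eq_empty_iff.2 fun T hT hc => ?_
      obtain ⟨p⟩ := conn_iff_reachable.1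
        (hc.mono (Finset.coe_subset.2 (mem_anchoredTrees.1 hT).1))
      exact absurd (hwalk p) (by simp)
    rw [pairSum, hempty, Finset.sum_empty]
    exact mul_nonneg (by positivity) (fFun_nonneg hΔ hL hρ _)
  | coe g =>
    have hg3 : 3 ≤ g := by exact_mod_cast hg
    have hsub : ((g : ℕ∞) - 2) = ((g - 2 : ℕ) : ℕ∞) := by
      push_cast
      rfl
    have hk : ((Δ - 1 : ℕ) : ℝ) = (Δ : ℝ) - 1 := by
      push_cast [Nat.cast_sub hΔ]
      ring
    have hxY : (L - 1) / L ^ (Δ - 1) * L ^ (Δ - 1) = L - 1 := by field_simp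
    have hy := mul_lt_one_of_lt_rho hΔ2 hL hρ
    have hkpos : 0 < (Δ : ℝ) - 1 := by
      have : (2 : ℝ) ≤ Δ := by exact_mod_cast hΔ2
      linarith
    rw [hsub, fFun_pow hΔ hL0, xFun_pow hΔ hL0]
    have h := pairSum_le (x := (L - 1) / L ^ (Δ - 1)) (Y := L ^ (Δ - 1)) (q := (L - 1) / L)
      (k := Δ - 1) (div_nonneg (by linarith) (by positivity)) (by positivity) (by omega)
      (by rw [hxY]; simp) (by rw [hxY]; simp) (by rw [hk]; exact hy) (edgesIn G W)
      (fun f hf => G.not_isDiag_of_mem_edgeSet (mem_edgesIn.1 hf).1)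
      (fun w => (edgeDeg_edgesIn_le W w).trans ((hdeg w).trans (by omega))) hvs
      (by
        have := edgeDeg_edgesIn_lt hu huv
        have := hdeg v
        omega) (d := g - 2) (by omega)
      (fun p => by
        have : g ≤ p.length + 2 := by exact_mod_cast hwalk p
        omega)
    rw [hk] at h
    refine h.trans ?_
    have h6 : 0 ≤ L - 1 := by linarith
    have h7 : 0 ≤ 1 - ((Δ : ℝ) - 1) * ((L - 1) / L) := by linarith
    have h8 : 0 ≤ 1 / ((Δ : ℝ) - 1) *
        ((((Δ : ℝ) - 1) * ((L - 1) / L)) ^ (g - 2) /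
          (1 - ((Δ : ℝ) - 1) * ((L - 1) / L))) := by positivity
    -- The estimate has `Y = L ^ (Δ - 1)`; it is weakened to `b = L ^ Δ` to match `K`.
    have h9 : L ^ (Δ - 1) ≤ L ^ Δ := pow_le_pow_right₀ hL (by omega)
    rw [div_eq_mul_one_div, mul_assoc]
    gcongr

end Graph

/-! ### The ratio bound on the closed disc and nonvanishing -/

section Main

variable {V : Type*} {G : SimpleGraph V} {r : Sym2 V → Sym2 V → Prop}

theorem isBCFForest_empty (hr : StrictTotalOn r G.edgeSet) : IsBCFForest G r ∅ := by
  rw [isBCFForest_iff hr]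
  refine ⟨Set.empty_subset _, fun x y hxy hc => hxy.ne ?_⟩
  exact conn_empty_iff.1 (hc.mono fun f hf => hf.1)

variable [Fintype V]

theorem norm_genFun_sub_le_of_lt_zRadius (hr : StrictTotalOn r G.edgeSet) {Δ : ℕ} (hΔ : 1 ≤ Δ)
    (hdeg : ∀ u, (Finset.univ.filter (G.Adj u)).card ≤ Δ) {g : ℕ∞} (hg : 3 ≤ g)
    (hGg : g ≤ G.egirth) {a : ℝ} (ha0 : 0 ≤ a) (ha : a < 1) {z : ℂ}
    (hz : ((‖z‖ : ℝ) : EReal) < zRadius Δ g a) (U : Set V) (u : V) :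
    ‖genFun (restrict G U) r z - genFun (restrict G (U \ {u})) r z‖ ≤
      a * ‖genFun (restrict G (U \ {u})) r z‖ := by
  obtain ⟨b, hb1, hbρ, hK, hzx⟩ := exists_kernel_of_lt_zRadius hΔ ha (norm_nonneg z) hz
  obtain ⟨L, hL, rfl⟩ : ∃ L : ℝ, 1 ≤ L ∧ L ^ Δ = b :=
    ⟨edgeRoot Δ b, one_le_edgeRoot hb1, edgeRoot_pow hΔ (by linarith)⟩
  have hx : 0 ≤ xFun Δ (L ^ Δ) := by
    rw [xFun_pow hΔ (by linarith)]
    exact div_nonneg (by linarith) (pow_nonneg (by linarith) _)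
  refine norm_genFun_sub_le_of_kernel hr (M := L ^ Δ * fFun Δ (g - 2) (L ^ Δ)) (Δ := Δ) ha0 ha hx
    hzx hb1 (mul_nonneg (by linarith) (fFun_nonneg hΔ hL hbρ _))
    (treeSum_edgesIn_le hΔ hdeg hL) (pairSum_edgesIn_le hΔ hdeg hg hGg hL hbρ) hdeg ?_ U u
  refine le_trans (le_of_eq ?_) hK
  rw [kFun]
  ring

theorem continuous_genFun (G : SimpleGraph V) (r : Sym2 V → Sym2 V → Prop) :
    Continuous (genFun G r) := by
  unfold genFun
  fun_prop

theorem genFun_zero (hr : StrictTotalOn r G.edgeSet) : genFun G r 0 = 1 := by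
  rw [genFun_eq, Finset.sum_eq_single ∅]
  · simp
  · intro A _ hA
    exact zero_pow (Finset.card_ne_zero.2 (Finset.nonempty_iff_ne_empty.2 hA))
  · intro h
    exact absurd (mem_bcfSets.2 (by simpa using isBCFForest_empty hr)) h

theorem genFun_restrict_empty (hr : StrictTotalOn r G.edgeSet) (z : ℂ) :
    genFun (restrict G ∅) r z = 1 := by
  rw [genFun_eq, Finset.sum_eq_single ∅]
  · simp
  · intro A hA hne
    obtain ⟨f, hf⟩ := Finset.nonempty_iff_ne_empty.2 hne
    have := (mem_edgeSet_restrict.1 ((mem_bcfSets.1 hA).1 hf)).2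
    induction f with
    | h x y => exact absurd (this x (by simp)) (Set.notMem_empty x)
  · intro h
    exact absurd (mem_bcfSets.2 (by
      simpa using isBCFForest_empty (hr.mono (edgeSet_restrict_subset G ∅)))) h

/-- The ratio bound on the closed disc. -/
theorem norm_genFun_sub_le_of_le_zRadius (hr : StrictTotalOn r G.edgeSet) {Δ : ℕ} (hΔ : 1 ≤ Δ)
    (hdeg : ∀ u, (Finset.univ.filter (G.Adj u)).card ≤ Δ) {g : ℕ∞} (hg : 3 ≤ g)
    (hGg : g ≤ G.egirth) {a : ℝ} (ha0 : 0 ≤ a) (ha : a < 1) {z : ℂ}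
    (hz : ((‖z‖ : ℝ) : EReal) ≤ zRadius Δ g a) (U : Set V) (u : V) :
    ‖genFun (restrict G U) r z - genFun (restrict G (U \ {u})) r z‖ ≤
      a * ‖genFun (restrict G (U \ {u})) r z‖ := by
  have hsub := edgeSet_restrict_subset G
  by_cases hz0 : z = 0
  · rw [hz0, genFun_zero (hr.mono (hsub _)), genFun_zero (hr.mono (hsub _)), sub_self, norm_zero]
    positivity
  -- For `z ≠ 0` the points `t * z` with `0 < t < 1` lie strictly inside the radius, and the
  -- inequality passes to the limit.
  have hscale : Filter.Tendsto (fun t : ℝ => (t : ℂ) * z) (nhdsWithin 1 (Set.Iio 1)) (nhds z) := by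
    have : Continuous fun t : ℝ => (t : ℂ) * z := by fun_prop
    have h := this.tendsto 1
    rw [Complex.ofReal_one, one_mul] at h
    exact h.mono_left nhdsWithin_le_nhds
  have h1 := ((continuous_genFun (restrict G U) r).tendsto z).comp hscale
  have h2 := ((continuous_genFun (restrict G (U \ {u})) r).tendsto z).comp hscale
  refine le_of_tendsto_of_tendsto (h1.sub h2).norm (h2.norm.const_mul a) ?_
  have hpos : ∀ᶠ t : ℝ in nhdsWithin 1 (Set.Iio 1), 0 < t :=
    nhdsWithin_le_nhds (lt_mem_nhds one_pos)
  filter_upwards [hpos, self_mem_nhdsWithin] with t ht0 ht1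
  refine norm_genFun_sub_le_of_lt_zRadius hr hΔ hdeg hg hGg ha0 ha (lt_of_lt_of_le ?_ hz) U u
  rw [EReal.coe_lt_coe_iff, norm_mul, Complex.norm_real, Real.norm_of_nonneg ht0.le]
  exact mul_lt_of_lt_one_left (norm_pos_iff.2 hz0) ht1

/-- Vertices are added one by one: a new zero would force `|F_S| ≤ a |F_S|` with `F_S ≠ 0` and `a <
1`. -/
theorem genFun_restrict_ne_zero (hr : StrictTotalOn r G.edgeSet) {a : ℝ} (ha : a < 1) {z : ℂ}
    (h : ∀ (U : Set V) (u : V),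
      ‖genFun (restrict G U) r z - genFun (restrict G (U \ {u})) r z‖ ≤
        a * ‖genFun (restrict G (U \ {u})) r z‖) (U : Set V) :
    genFun (restrict G U) r z ≠ 0 := by
  induction U, Set.toFinite U using Set.Finite.induction_on with
  | empty =>
    rw [genFun_restrict_empty hr]
    exact one_ne_zero
  | @insert u S hu _ ih =>
    intro h0
    have h1 := h (insert u S) u
    rw [h0, Set.insert_sdiff_self_of_notMem hu, zero_sub, norm_neg] at h1
    have := norm_pos_iff.2 ih
    nlinarith

end Main

end Development

end BCF

theorem proposition3 {V : Type*} [Fintype V] (G : SimpleGraph V) [DecidableRel G.Adj]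
    (r : Sym2 V → Sym2 V → Prop)
    (hr : IsStrictTotalOrder G.edgeSet (fun e f => r (e : Sym2 V) (f : Sym2 V)))
    (Δ : ℕ) (hΔ : 1 ≤ Δ) (hGΔ : G.maxDegree = Δ)
    (g : ℕ∞) (hg : 3 ≤ g) (hGg : G.egirth = g)
    (a : ℝ) (ha0 : 0 ≤ a) (ha1 : a ≤ 1)
    (z : ℂ) (hz : ((‖z‖ : ℝ) : EReal) ≤ BCF.zRadius Δ g a) :
    BCF.genFun G r z ≠ 0 ∧
      ∀ u : V, BCF.genFunDelete G r u z ≠ 0 ∧ ‖BCF.ratio G r u z‖ ≤ a := by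
  have hord : BCF.StrictTotalOn r G.edgeSet :=
    { irrefl := fun e he => hr.irrefl ⟨e, he⟩
      trans := fun e he f hf k hk => hr.trans ⟨e, he⟩ ⟨f, hf⟩ ⟨k, hk⟩
      total := fun e he f hf hne => by
        by_contra hcon
        push Not at hcon
        have := hr.trichotomous ⟨e, he⟩ ⟨f, hf⟩ hcon.1 hcon.2
        exact hne (congrArg Subtype.val this) }
  have hdeg : ∀ u, (G.neighborFinset u).card ≤ Δ := fun u => by
    rw [← hGΔ, SimpleGraph.card_neighborFinset_eq_degree]
    exact G.degree_le_maxDegree u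
  rcases ha1.lt_or_eq with ha | rfl
  · have hmain := BCF.norm_genFun_sub_le_of_le_zRadius hord hΔ
      (fun u => le_of_eq_of_le (by congr 1; ext w; simp) (hdeg u)) hg hGg.ge ha0 ha hz
    have hne := BCF.genFun_restrict_ne_zero hord ha hmain
    have hU := hne Set.univ
    rw [BCF.restrict_univ] at hU
    refine ⟨hU, fun u => ⟨hne _, ?_⟩⟩
    have h1 := hmain Set.univ u
    rw [BCF.restrict_univ, ← Set.compl_eq_univ_sdiff] at h1
    have h2 : BCF.genFunDelete G r u z ≠ 0 := hne _
    rw [BCF.ratio, div_sub_one h2, norm_div, div_le_iff₀ (norm_pos_iff.2 h2)]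
    exact h1
  · have hz0 : z = 0 := by
      -- The factor `1 - a` vanishes, and `0 * ⊤ = 0` in `EReal`.
      have h0 : BCF.zRadius Δ g 1 = 0 := by
        rw [BCF.zRadius]
        split_ifs
        · rfl
        · simp
      rw [h0] at hz
      have : ‖z‖ ≤ 0 := by exact_mod_cast hz
      simpa using this
    subst hz0
    have h1 : BCF.genFun G r 0 = 1 := BCF.genFun_zero hord
    have h2 : ∀ u, BCF.genFunDelete G r u 0 = 1 := fun u =>
      BCF.genFun_zero (hord.mono (BCF.edgeSet_restrict_subset G _))
    refine ⟨by rw [h1]; exact one_ne_zero, fun u => ⟨by rw [h2]; exact one_ne_zero, ?_⟩⟩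
    rw [BCF.ratio, h1, h2]
    simp
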